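/- Let $\mathbb{H}=[0,1]^2$ with the Euclidean distance $d$, and let $k\ge 1$ be an integer. The initial group $G^0$ consists of $k$ points chosen independently and uniformly at random in $\mathbb{H}$. In each round $t=1,2,\dots$ two candidates $w^t_1,w^t_2$ are chosen uniformly at random in $\mathbb{H}$, all these choices (initial members and candidates of all rounds) being independent. A member $v\in G^{t-1}$ votes for $w^t_j$ if and only if $d(v,w^t_j)\le d(v,w^t_i)$ for the other candidate $w^t_i$. If every member of $G^{t-1}$ votes for $w^t_j$, then $w^t_j$ joins the group, $G^t=G^{t-1}\cup\{w^t_j\}$; if no candidate gets all the votes, then $G^t=G^{t-1}$. (With probability one, at most one candidate gets all the votes in each round.) Then there are constants $c,C>0$, depending only on $k$, such that the expected cardinality of the group after $T$ rounds satisfies $$c\,\ln T\;\le\;\mathbb{E}\big[|G^T|\big]\quad\text{for all integers }T\ge 1,\qquad \mathbb{E}\big[|G^T|\big]\;\le\;C\,\ln T\cdot\ln\ln T\quad\text{for all integers }T\ge 3 .$$ -/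

import Mathlib

open MeasureTheory ProbabilityTheory

/-- The voter at `v` votes for the candidate `c j`: no other candidate is strictly closer to `v`. -/
def VotesFor {X : Type*} [MetricSpace X] {n : ℕ} (v : X) (c : Fin n → X) (j : Fin n) : Prop :=
  ∀ i, i ≠ j → dist v (c j) ≤ dist v (c i)

/-- One election under consensus voting: the group `G` is enlarged by each candidate that receives
the vote of every member of `G`, and is unchanged if there is no such candidate. -/
def consensusStep {X : Type*} [MetricSpace X] {n : ℕ} (G : Set X) (c : Fin n → X) : Set X :=
  G ∪ {x | ∃ j, x = c j ∧ ∀ v ∈ G, VotesFor v c j}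

/-- The group after `t` rounds of consensus voting, started from `G₀`, where the candidates
in round `t + 1` are the entries of `c t`. -/
def socialGroup {X : Type*} [MetricSpace X] {n : ℕ} (G₀ : Set X) (c : ℕ → Fin n → X) : ℕ → Set X
  | 0 => G₀
  | t + 1 => consensusStep (socialGroup G₀ c t) (c t)

/-- The unit square in the Euclidean plane. -/
def unitSquare : Set (EuclideanSpace ℝ (Fin 2)) := {x | ∀ i, x i ∈ Set.Icc (0 : ℝ) 1}

/-- The random group after `T` rounds: the initial members are `v 0, …, v (k - 1)`, and the two
candidates in round `t + 1` are `w t 0` and `w t 1`. -/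
def randomGroup {Ω : Type*} {k : ℕ} (v : Fin k → Ω → EuclideanSpace ℝ (Fin 2))
    (w : ℕ → Fin 2 → Ω → EuclideanSpace ℝ (Fin 2)) (T : ℕ) (ω : Ω) :
    Set (EuclideanSpace ℝ (Fin 2)) :=
  socialGroup (Set.range fun i => v i ω) (fun t j => w t j ω) T

/-! Upper bound. The expected size is at most `k` plus the sum, over rounds and candidates, of the
probability of a unanimous vote. A symmetry of the square makes the displacement from loser to
winner satisfy `0 ≤ a ≤ b`, with `b > 0`. The voters for the winner are then the `z` with `a * z.1 +
b * z.2 ≥ c`, so, if `c > 0`, unanimity means that the group misses the corner triangle with legs `c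
/ a` and `c / b`. Legs near `2⁻ⁱ` and `2⁻ʲ`, with `i ≤ j`, occur with probability `O(16⁻ʲ)`,
uniformly in `i` (`pairLaw_capClass_le`).

Suppose an earlier round showed a suitable pair inside this triangle. If all members, then and
later, lie beyond the bisector, the first point of that pair was elected; but it lies inside the
triangle and vetoes the present winner (`blockingBox_defeats`). Such pairs exist at every scale
`2⁻ᵐ` with `i ≤ m ≤ j`, disjointly and each with probability of order `16⁻ʲ`. Summing the geometric
series over the rounds leaves `O(1 / (j - i + 1))` per class; summing over `i` gives a harmonic
number `O(ln j)`, and over `j ≤ J` gives `O(J ln J)`. With `J` about `log₂ T`, the remaining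
bisectors, which pass even closer to the corner, contribute `O(1)`. Using all scales `m`, not just
one, is what gives `ln T · ln ln T` in place of `(ln T)²`.

Lower bound. With probability `100⁻ᵏ` the initial members all lie near `(1, 1)`. A candidate within
`ε` of the origin in both coordinates can then win only against an opponent within `5ε`
(`le_of_prefers_of_near_corner`), so the `ε`-corner stays empty unless a round has both candidates
in the `5ε`-corner, an event of probability `625ε⁴`. For `ε` of order `t^(-1/4)` it is empty after
`t` rounds with probability bounded below, and the next round then elects a new member there with
probability of order `ε⁴`, that is `1 / t`. Summing over `t` gives `ln T`. -/

theorem finite_setOf_eq_and {X : Type*} (a : X) (p : Prop) : {x | x = a ∧ p}.Finite :=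
  (Set.finite_singleton a).subset fun _ h => h.1

open Classical in
theorem ncard_union_setOf_eq_and {X : Type*} {G : Set X} (hG : G.Finite) (a : X) (p : Prop) :
    (G ∪ {x | x = a ∧ p}).ncard = G.ncard + if p ∧ a ∉ G then 1 else 0 := by
  by_cases hp : p
  · have : G ∪ {x | x = a ∧ p} = insert a G := by ext x; simp [hp]
    rw [this]
    by_cases ha : a ∈ G
    · simp [ha, Set.insert_eq_of_mem ha]
    · simp [ha, hp, Set.ncard_insert_of_notMem ha hG]
  · simp [hp]

/-! ### Consensus voting along a fixed sequence of candidates -/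

section Deterministic

variable {X : Type*} [MetricSpace X] {n : ℕ}

/-- Every member of `G` votes for candidate `j`. -/
def Unanimous (G : Set X) (c : Fin n → X) (j : Fin n) : Prop := ∀ v ∈ G, VotesFor v c j

theorem socialGroup_mono (G₀ : Set X) (c : ℕ → Fin n → X) : Monotone (socialGroup G₀ c) :=
  monotone_nat_of_le_succ fun _ => Set.subset_union_left

theorem mem_socialGroup_succ {G₀ : Set X} {c : ℕ → Fin n → X} {t : ℕ} {x : X} :
    x ∈ socialGroup G₀ c (t + 1) ↔
      x ∈ socialGroup G₀ c t ∨ ∃ j, x = c t j ∧ Unanimous (socialGroup G₀ c t) (c t) j :=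
  Iff.rfl

theorem socialGroup_subset {G₀ S : Set X} {c : ℕ → Fin n → X} (h₀ : G₀ ⊆ S)
    (hc : ∀ t j, c t j ∈ S) (t : ℕ) : socialGroup G₀ c t ⊆ S := by
  induction t with
  | zero => exact h₀
  | succ t ih =>
    intro x hx
    rcases mem_socialGroup_succ.1 hx with h | ⟨j, rfl, -⟩
    exacts [ih h, hc t j]

theorem votesFor_iff_rev {v : X} {c : Fin 2 → X} {j : Fin 2} :
    VotesFor v c j ↔ dist v (c j) ≤ dist v (c j.rev) := by
  fin_cases j
  · simp [VotesFor, Fin.forall_fin_two]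
  · simp [VotesFor, Fin.forall_fin_two]

theorem consensusStep_eq (G : Set X) (c : Fin 2 → X) :
    consensusStep G c =
      (G ∪ {x | x = c 0 ∧ Unanimous G c 0}) ∪ {x | x = c 1 ∧ Unanimous G c 1} := by
  ext x
  simp only [consensusStep, Set.mem_union, Set.mem_ofPred_eq, Unanimous]
  rw [Fin.exists_fin_two, or_assoc]

theorem consensusStep_finite {G : Set X} (hG : G.Finite) (c : Fin 2 → X) :
    (consensusStep G c).Finite := by
  rw [consensusStep_eq]
  exact (hG.union (finite_setOf_eq_and _ _)).union (finite_setOf_eq_and _ _)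

theorem socialGroup_finite {G₀ : Set X} (h : G₀.Finite) (c : ℕ → Fin 2 → X) (t : ℕ) :
    (socialGroup G₀ c t).Finite := by
  induction t with
  | zero => exact h
  | succ t ih => exact consensusStep_finite ih _

-- An exact count, needed for the measurability of the cardinality. The last condition prevents
-- counting the same point twice when the two candidates coincide.
open Classical in
theorem ncard_consensusStep {G : Set X} (hG : G.Finite) (c : Fin 2 → X) :
    (consensusStep G c).ncard = G.ncard + (if Unanimous G c 0 ∧ c 0 ∉ G then 1 else 0) +
      if Unanimous G c 1 ∧ c 1 ∉ G ∧ ¬ (c 1 = c 0 ∧ Unanimous G c 0) then 1 else 0 := by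
  rw [consensusStep_eq, ncard_union_setOf_eq_and (hG.union (finite_setOf_eq_and _ _)),
    ncard_union_setOf_eq_and hG]
  simp only [Set.mem_union, Set.mem_ofPred_eq, not_or]

open Classical in
theorem ncard_consensusStep_le {G : Set X} (hG : G.Finite) (c : Fin 2 → X) :
    (consensusStep G c).ncard ≤ G.ncard + ∑ j, if Unanimous G c j then 1 else 0 := by
  rw [ncard_consensusStep hG, Fin.sum_univ_two]
  have h₀ : (if Unanimous G c 0 ∧ c 0 ∉ G then 1 else 0) ≤ if Unanimous G c 0 then 1 else 0 := by
    split_ifs <;> simp_all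
  have h₁ : (if Unanimous G c 1 ∧ c 1 ∉ G ∧ ¬ (c 1 = c 0 ∧ Unanimous G c 0) then 1 else 0) ≤
      if Unanimous G c 1 then 1 else 0 := by
    split_ifs <;> simp_all
  omega

theorem ncard_add_one_le_consensusStep {G : Set X} (hG : G.Finite) {c : Fin 2 → X}
    (h : Unanimous G c 0) (h' : c 0 ∉ G) : G.ncard + 1 ≤ (consensusStep G c).ncard := by
  classical
  rw [ncard_consensusStep hG, if_pos ⟨h, h'⟩]
  omega

open Classical in
theorem ncard_socialGroup_le {G₀ : Set X} (h : G₀.Finite) (c : ℕ → Fin 2 → X) (T : ℕ) :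
    (socialGroup G₀ c T).ncard ≤ G₀.ncard +
      ∑ t ∈ Finset.range T, ∑ j, if Unanimous (socialGroup G₀ c t) (c t) j then 1 else 0 := by
  induction T with
  | zero => simp [socialGroup]
  | succ T ih =>
    rw [Finset.sum_range_succ]
    have := ncard_consensusStep_le (socialGroup_finite h c T) (c T)
    have e : socialGroup G₀ c (T + 1) = consensusStep (socialGroup G₀ c T) (c T) := rfl
    rw [e]
    omega

end Deterministic

theorem randomGroup_finite {Ω : Type*} {k : ℕ} (v : Fin k → Ω → EuclideanSpace ℝ (Fin 2))
    (w : ℕ → Fin 2 → Ω → EuclideanSpace ℝ (Fin 2)) (T : ℕ) (ω : Ω) :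
    (randomGroup v w T ω).Finite :=
  socialGroup_finite (Set.finite_range _) _ T

theorem ncard_range_le {k : ℕ} (u : Fin k → EuclideanSpace ℝ (Fin 2)) :
    (Set.range u).ncard ≤ k := by
  rw [← Set.image_univ]
  exact (Set.ncard_image_le).trans (by simp)

open Classical in
theorem ncard_randomGroup_le {Ω : Type*} {k : ℕ}
    (v : Fin k → Ω → EuclideanSpace ℝ (Fin 2)) (w : ℕ → Fin 2 → Ω → EuclideanSpace ℝ (Fin 2))
    (T : ℕ) (ω : Ω) :
    (randomGroup v w T ω).ncard ≤ k + ∑ t ∈ Finset.range T, ∑ j,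
      if Unanimous (randomGroup v w t ω) (fun j => w t j ω) j then 1 else 0 :=
  (ncard_socialGroup_le (Set.finite_range _) _ T).trans
    (Nat.add_le_add_right (ncard_range_le _) _)

/-! ### Measurability and integrability of the group size -/

section Measurability

variable {Ω : Type*} [MeasurableSpace Ω] {k : ℕ}
  {v : Fin k → Ω → EuclideanSpace ℝ (Fin 2)} {w : ℕ → Fin 2 → Ω → EuclideanSpace ℝ (Fin 2)}

theorem measurableSet_votesFor (hw : ∀ t j, Measurable (w t j)) (t : ℕ) (j : Fin 2) :
    MeasurableSet {p : Ω × EuclideanSpace ℝ (Fin 2) |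
      VotesFor p.2 (fun j => w t j p.1) j} := by
  have h := hw t
  simp only [votesFor_iff_rev]
  refine measurableSet_le ?_ ?_
  · exact measurable_snd.dist ((h j).comp measurable_fst)
  · exact measurable_snd.dist ((h j.rev).comp measurable_fst)

/-- Events of this form reduce questions about a random set to induction on rounds. The relation `B`
must be arbitrary: the inductive step uses the hypothesis both for `B` and for the relation of
voting for a candidate, which decides who joins. -/
theorem measurableSet_forall_mem_randomGroup (hv : ∀ i, Measurable (v i))
    (hw : ∀ t j, Measurable (w t j)) (T : ℕ) {B : Set (Ω × EuclideanSpace ℝ (Fin 2))}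
    (hB : MeasurableSet B) : MeasurableSet {ω | ∀ z ∈ randomGroup v w T ω, (ω, z) ∈ B} := by
  induction T generalizing B with
  | zero =>
    have : {ω | ∀ z ∈ randomGroup v w 0 ω, (ω, z) ∈ B} = ⋂ i, {ω | (ω, v i ω) ∈ B} := by
      ext ω
      simp [randomGroup, socialGroup]
    rw [this]
    exact MeasurableSet.iInter fun i => (measurable_id.prodMk (hv i)) hB
  | succ T ih =>
    have : {ω | ∀ z ∈ randomGroup v w (T + 1) ω, (ω, z) ∈ B} =
        {ω | ∀ z ∈ randomGroup v w T ω, (ω, z) ∈ B} ∩ ⋂ j,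
          ({ω | ∀ z ∈ randomGroup v w T ω,
            (ω, z) ∈ {p : Ω × EuclideanSpace ℝ (Fin 2) |
              VotesFor p.2 (fun j => w T j p.1) j}}ᶜ ∪ {ω | (ω, w T j ω) ∈ B}) := by
      ext ω
      simp only [Set.mem_ofPred_eq, Set.mem_inter_iff, Set.mem_iInter, Set.mem_union,
        Set.mem_compl_iff, ← imp_iff_not_or]
      simp only [randomGroup, mem_socialGroup_succ, Unanimous]
      constructor
      · exact fun h => ⟨fun z hz => h z (Or.inl hz), fun j hj => h _ (Or.inr ⟨j, rfl, hj⟩)⟩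
      · rintro ⟨h₁, h₂⟩ z (hz | ⟨j, rfl, hj⟩)
        exacts [h₁ z hz, h₂ j hj]
    rw [this]
    exact (ih hB).inter (MeasurableSet.iInter fun j =>
      (ih (measurableSet_votesFor hw T j)).compl.union
        ((measurable_id.prodMk (hw T j)) hB))

theorem measurableSet_unanimous (hv : ∀ i, Measurable (v i))
    (hw : ∀ t j, Measurable (w t j)) (T : ℕ) (j : Fin 2) :
    MeasurableSet {ω | Unanimous (randomGroup v w T ω) (fun j => w T j ω) j} :=
  measurableSet_forall_mem_randomGroup hv hw T (measurableSet_votesFor hw T j)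

theorem measurableSet_notMem_randomGroup (hv : ∀ i, Measurable (v i))
    (hw : ∀ t j, Measurable (w t j)) (T t : ℕ) (j : Fin 2) :
    MeasurableSet {ω | w t j ω ∉ randomGroup v w T ω} := by
  have hB : MeasurableSet {p : Ω × EuclideanSpace ℝ (Fin 2) | p.2 ≠ w t j p.1} :=
    (measurableSet_eq_fun measurable_snd ((hw t j).comp measurable_fst)).compl
  convert measurableSet_forall_mem_randomGroup hv hw T hB using 1
  ext ω
  simp only [Set.mem_ofPred_eq]
  exact ⟨fun h z hz e => h (e ▸ hz), fun h hz => h _ hz rfl⟩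

theorem measurable_ncard_randomGroup (hv : ∀ i, Measurable (v i))
    (hw : ∀ t j, Measurable (w t j)) (T : ℕ) :
    Measurable fun ω => (randomGroup v w T ω).ncard := by
  classical
  induction T with
  | zero =>
    -- Coinciding initial members are counted once, at their least index.
    have h : ∀ ω, (randomGroup v w 0 ω).ncard =
        ∑ i, if ∀ i' < i, v i' ω ≠ v i ω then 1 else 0 := by
      intro ω
      rw [← Finset.card_filter]
      have : randomGroup v w 0 ω =
          (fun i => v i ω) '' (Finset.univ.filter fun i => ∀ i' < i, v i' ω ≠ v i ω) := by
        ext x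
        simp only [randomGroup, socialGroup, Set.mem_range, Finset.coe_filter, Finset.mem_univ,
          true_and, Set.mem_image, Set.mem_ofPred_eq]
        constructor
        · rintro ⟨i, rfl⟩
          obtain ⟨m, hm, hmin⟩ := WellFounded.has_min (wellFounded_lt (α := Fin k))
            {i' | v i' ω = v i ω} ⟨i, rfl⟩
          exact ⟨m, fun i' hi' e => hmin i' (e.trans hm) hi', hm⟩
        · rintro ⟨i, -, rfl⟩
          exact ⟨i, rfl⟩
      rw [this, Set.InjOn.ncard_image, Set.ncard_coe_finset]
      intro i hi i' hi' e
      simp only [Finset.coe_filter, Finset.mem_univ, true_and, Set.mem_ofPred_eq] at hi hi'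
      rcases lt_trichotomy i i' with h | h | h
      exacts [(hi' i h e).elim, h, (hi i' h e.symm).elim]
    simp only [h]
    refine Finset.measurable_sum _ fun i _ => Measurable.ite ?_ measurable_const measurable_const
    have : {ω | ∀ i' < i, v i' ω ≠ v i ω} = ⋂ i', ⋂ (_ : i' < i), {ω | v i' ω = v i ω}ᶜ := by
      ext; simp
    rw [this]
    exact MeasurableSet.iInter fun i' => MeasurableSet.iInter fun _ =>
      (measurableSet_eq_fun (hv i') (hv i)).compl
  | succ T ih =>
    have h : ∀ ω, (randomGroup v w (T + 1) ω).ncard = _ := fun ω =>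
      ncard_consensusStep (randomGroup_finite v w T ω) (fun j => w T j ω)
    simp only [h]
    have m0 := measurableSet_unanimous hv hw T 0
    have m1 := measurableSet_unanimous hv hw T 1
    refine (ih.add (Measurable.ite ?_ measurable_const measurable_const)).add
      (Measurable.ite ?_ measurable_const measurable_const)
    · exact m0.inter (measurableSet_notMem_randomGroup hv hw T T 0)
    · exact m1.inter ((measurableSet_notMem_randomGroup hv hw T T 1).inter
        ((measurableSet_eq_fun (hw T 1) (hw T 0)).inter m0).compl)

theorem integrable_ncard_randomGroup (P : Measure Ω) [IsProbabilityMeasure P]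
    (hv : ∀ i, Measurable (v i)) (hw : ∀ t j, Measurable (w t j)) (T : ℕ) :
    Integrable (fun ω => ((randomGroup v w T ω).ncard : ℝ)) P := by
  classical
  refine Integrable.of_bound (C := k + 2 * T)
    (measurable_from_nat.comp (measurable_ncard_randomGroup hv hw T)).aestronglyMeasurable
    (Filter.Eventually.of_forall fun ω => ?_)
  have h := ncard_randomGroup_le v w T ω
  have h' : ∑ t ∈ Finset.range T, ∑ j : Fin 2,
      (if Unanimous (randomGroup v w t ω) (fun j => w t j ω) j then 1 else 0) ≤ T * 2 := by
    refine (Finset.sum_le_card_nsmul _ _ 2 fun t _ => ?_).trans (by simp)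
    refine (Finset.sum_le_card_nsmul _ _ 1 fun j _ => ?_).trans (by simp)
    split_ifs <;> simp
  rw [Real.norm_natCast]
  exact_mod_cast (by omega : (randomGroup v w T ω).ncard ≤ k + 2 * T)

end Measurability

/-! ### Bisectors near a corner: probabilities and blocking pairs -/

section Plane

/-- The closed unit square in the coordinate plane. -/
def coordSquare : Set (ℝ × ℝ) := Set.Icc 0 1 ×ˢ Set.Icc 0 1

theorem mem_coordSquare {p : ℝ × ℝ} :
    p ∈ coordSquare ↔ (0 ≤ p.1 ∧ p.1 ≤ 1) ∧ 0 ≤ p.2 ∧ p.2 ≤ 1 := Iff.rfl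

theorem measurableSet_coordSquare : MeasurableSet coordSquare :=
  measurableSet_Icc.prod measurableSet_Icc

theorem volume_coordSquare : volume coordSquare = 1 := by
  rw [coordSquare, Measure.volume_eq_prod, Measure.prod_prod, Real.volume_Icc]
  norm_num

/-- The uniform distribution on the unit square, in coordinates. -/
noncomputable def squareLaw : Measure (ℝ × ℝ) := volume.restrict coordSquare

instance : IsProbabilityMeasure squareLaw :=
  ⟨by rw [squareLaw, Measure.restrict_apply_univ, volume_coordSquare]⟩

/-- The law of a pair of independent uniform points of the unit square. -/
noncomputable def pairLaw : Measure ((ℝ × ℝ) × (ℝ × ℝ)) := squareLaw.prod squareLaw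

instance : IsProbabilityMeasure pairLaw := by unfold pairLaw; infer_instance

theorem pairLaw_eq : pairLaw = volume.restrict (coordSquare ×ˢ coordSquare) := by
  rw [pairLaw, squareLaw, Measure.prod_restrict, ← Measure.volume_eq_prod]

/-- Pairs of points described by the horizontal displacement, the height of the first point and the
coordinates of the second point. -/
def shearedBox (I J K L : Set ℝ) : Set ((ℝ × ℝ) × (ℝ × ℝ)) :=
  {p | p.1.1 - p.2.1 ∈ I ∧ p.1.2 ∈ J ∧ p.2.1 ∈ K ∧ p.2.2 ∈ L}

theorem measurableSet_shearedBox {I J K L : Set ℝ} (hI : MeasurableSet I) (hJ : MeasurableSet J)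
    (hK : MeasurableSet K) (hL : MeasurableSet L) : MeasurableSet (shearedBox I J K L) := by
  refine MeasurableSet.inter ?_ (MeasurableSet.inter ?_ (MeasurableSet.inter ?_ ?_))
  · exact (measurable_fst.fst.sub measurable_snd.fst) hI
  · exact measurable_fst.snd hJ
  · exact measurable_snd.fst hK
  · exact measurable_snd.snd hL

/-- For a fixed second point the slice is a translate of `I ×ˢ J`. Sheared coordinates suit the
estimates below, where the horizontal displacement has scale `B ^ 2 / A` and the abscissa of the
second point scale `A`: the product is free of `A`. -/
theorem volume_shearedBox {I J K L : Set ℝ} (hI : MeasurableSet I) (hJ : MeasurableSet J)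
    (hK : MeasurableSet K) (hL : MeasurableSet L) :
    volume (shearedBox I J K L) = volume I * volume J * (volume K * volume L) := by
  rw [Measure.volume_eq_prod, Measure.prod_apply_symm (measurableSet_shearedBox hI hJ hK hL)]
  have h : ∀ y : ℝ × ℝ, volume ((fun x => (x, y)) ⁻¹' shearedBox I J K L) =
      (K ×ˢ L).indicator (fun _ => volume I * volume J) y := by
    intro y
    by_cases hy : y ∈ K ×ˢ L
    · rw [Set.indicator_of_mem hy]
      have : (fun x : ℝ × ℝ => (x, y)) ⁻¹' shearedBox I J K L =
          ((fun s => s - y.1) ⁻¹' I) ×ˢ J := by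
        ext x
        simp only [shearedBox, Set.mem_preimage, Set.mem_ofPred_eq, Set.mem_prod]
        exact ⟨fun h => ⟨h.1, h.2.1⟩, fun h => ⟨h.1, h.2, hy⟩⟩
      rw [this, Measure.volume_eq_prod, Measure.prod_prod,
        (measurePreserving_sub_right volume y.1).measure_preimage hI.nullMeasurableSet]
    · rw [Set.indicator_of_notMem hy]
      have : (fun x : ℝ × ℝ => (x, y)) ⁻¹' shearedBox I J K L = ∅ := by
        ext x
        simp only [shearedBox, Set.mem_preimage, Set.mem_ofPred_eq, Set.mem_empty_iff_false,
          iff_false]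
        exact fun h => hy h.2.2
      rw [this, measure_empty]
  simp only [h]
  rw [lintegral_indicator (hK.prod hL), setLIntegral_const, Measure.volume_eq_prod,
    Measure.prod_prod]

theorem pairLaw_real_le_of_subset {S : Set ((ℝ × ℝ) × (ℝ × ℝ))} {a b c d : ℝ}
    (ha : 0 ≤ a) (hb : 0 ≤ b) (hc : 0 ≤ c) (hd : 0 ≤ d)
    (h : ∀ p ∈ S, p.1 ∈ coordSquare → p.2 ∈ coordSquare →
      p ∈ shearedBox (Set.Icc 0 a) (Set.Icc 0 b) (Set.Icc 0 c) (Set.Icc 0 d)) :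
    pairLaw.real S ≤ a * b * (c * d) := by
  have hm := measurableSet_shearedBox (I := Set.Icc 0 a) (J := Set.Icc 0 b) (K := Set.Icc 0 c)
    (L := Set.Icc 0 d) measurableSet_Icc measurableSet_Icc measurableSet_Icc measurableSet_Icc
  refine ENNReal.toReal_le_of_le_ofReal (by positivity) ?_
  calc pairLaw S = volume (S ∩ coordSquare ×ˢ coordSquare) := by
        rw [pairLaw_eq, Measure.restrict_apply'
          (measurableSet_coordSquare.prod measurableSet_coordSquare)]
    _ ≤ volume (shearedBox (Set.Icc 0 a) (Set.Icc 0 b) (Set.Icc 0 c) (Set.Icc 0 d)) :=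
        measure_mono fun p hp => h p hp.1 hp.2.1 hp.2.2
    _ = _ := by
        rw [volume_shearedBox measurableSet_Icc measurableSet_Icc measurableSet_Icc
          measurableSet_Icc]
        simp only [Real.volume_Icc, sub_zero]
        rw [← ENNReal.ofReal_mul ha, ← ENNReal.ofReal_mul hc, ← ENNReal.ofReal_mul (by positivity)]

/-- The signed quantity `c` such that `z` is at least as close to `p.1` as to `p.2` if and only if
`c` is at most the inner product of `z` with `p.1 - p.2`. -/
noncomputable def bisectorLevel (p : (ℝ × ℝ) × (ℝ × ℝ)) : ℝ :=
  (p.1.1 ^ 2 + p.1.2 ^ 2 - p.2.1 ^ 2 - p.2.2 ^ 2) / 2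

/-- `z` is at least as close to `p.1` as to `p.2`. -/
def Prefers (z : ℝ × ℝ) (p : (ℝ × ℝ) × (ℝ × ℝ)) : Prop :=
  bisectorLevel p ≤ (p.1.1 - p.2.1) * z.1 + (p.1.2 - p.2.2) * z.2

theorem prefers_iff {z : ℝ × ℝ} {p : (ℝ × ℝ) × (ℝ × ℝ)} :
    Prefers z p ↔ (z.1 - p.1.1) ^ 2 + (z.2 - p.1.2) ^ 2 ≤
      (z.1 - p.2.1) ^ 2 + (z.2 - p.2.2) ^ 2 := by
  unfold Prefers bisectorLevel
  constructor <;> intro h <;> nlinarith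

/-- Pairs whose bisector cuts a triangle with legs at least `2⁻ⁱ` and `2⁻ʲ` off the corner at the
origin, these bounds being tight up to a factor of two unless the exponent vanishes. -/
def capClass (i j : ℕ) : Set ((ℝ × ℝ) × (ℝ × ℝ)) :=
  {p | 0 ≤ p.1.1 - p.2.1 ∧ 0 < p.1.2 - p.2.2 ∧
    (p.1.2 - p.2.2) * (1 / 2) ^ j ≤ bisectorLevel p ∧
    (p.1.1 - p.2.1) * (1 / 2) ^ i ≤ bisectorLevel p ∧
    (1 ≤ j → bisectorLevel p < 2 * (p.1.2 - p.2.2) * (1 / 2) ^ j) ∧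
    (1 ≤ i → bisectorLevel p < 2 * (p.1.1 - p.2.1) * (1 / 2) ^ i)}

/-- Pairs whose bisector comes within `2⁻ᴶ` of the origin along the second axis. -/
def thinClass (J : ℕ) : Set ((ℝ × ℝ) × (ℝ × ℝ)) :=
  {p | 0 ≤ p.1.1 - p.2.1 ∧ 0 < p.1.2 - p.2.2 ∧
    bisectorLevel p < (p.1.2 - p.2.2) * (1 / 2) ^ J}

theorem measurable_bisectorLevel : Measurable bisectorLevel := by
  unfold bisectorLevel; fun_prop

theorem measurableSet_capClass (i j : ℕ) : MeasurableSet (capClass i j) := by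
  have hb := measurable_bisectorLevel
  simp only [capClass, Set.ofPred_and]
  refine MeasurableSet.inter (measurableSet_le ?_ ?_) (MeasurableSet.inter (measurableSet_lt ?_ ?_)
    (MeasurableSet.inter (measurableSet_le ?_ ?_) (MeasurableSet.inter (measurableSet_le ?_ ?_)
    (MeasurableSet.inter ((MeasurableSet.const _).imp (measurableSet_lt ?_ ?_))
      ((MeasurableSet.const _).imp (measurableSet_lt ?_ ?_)))))) <;> fun_prop

theorem measurableSet_thinClass (J : ℕ) : MeasurableSet (thinClass J) := by
  have hb := measurable_bisectorLevel
  simp only [thinClass, Set.ofPred_and]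
  refine MeasurableSet.inter (measurableSet_le ?_ ?_) (MeasurableSet.inter (measurableSet_lt ?_ ?_)
      (measurableSet_lt ?_ ?_)) <;> fun_prop

/-- Take `j` and `i` to be the least exponents for which the leg bounds hold. Minimality gives the
converse bounds up to a factor of two, and `i ≤ j` because the first displacement is at most the
second. -/
theorem exists_capClass_or_thinClass {p : (ℝ × ℝ) × (ℝ × ℝ)} (h₀ : 0 ≤ p.1.1 - p.2.1)
    (h₁ : p.1.1 - p.2.1 ≤ p.1.2 - p.2.2) (h₂ : 0 < p.1.2 - p.2.2) (J : ℕ) :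
    p ∈ thinClass J ∨ ∃ j ≤ J, ∃ i ≤ j, p ∈ capClass i j := by
  classical
  by_cases h : bisectorLevel p < (p.1.2 - p.2.2) * (1 / 2) ^ J
  · exact Or.inl ⟨h₀, h₂, h⟩
  right
  have hJ : ∃ j, (p.1.2 - p.2.2) * (1 / 2) ^ j ≤ bisectorLevel p := ⟨J, not_lt.1 h⟩
  have hj := Nat.find_spec hJ
  have hI : ∃ i, (p.1.1 - p.2.1) * (1 / 2) ^ i ≤ bisectorLevel p :=
    ⟨Nat.find hJ, (mul_le_mul_of_nonneg_right h₁ (by positivity)).trans hj⟩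
  have key : ∀ a : ℝ, ∀ (H : ∃ i, a * (1 / 2 : ℝ) ^ i ≤ bisectorLevel p),
      1 ≤ Nat.find H → bisectorLevel p < 2 * a * (1 / 2) ^ Nat.find H := by
    intro a H h1
    have := Nat.find_min H (m := Nat.find H - 1) (by omega)
    rw [not_le] at this
    refine this.trans_eq ?_
    obtain ⟨m, hm⟩ : ∃ m, Nat.find H = m + 1 := ⟨Nat.find H - 1, by omega⟩
    rw [hm, Nat.add_sub_cancel, pow_succ]
    ring
  refine ⟨Nat.find hJ, Nat.find_min' hJ (not_lt.1 h), Nat.find hI,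
    Nat.find_min' hI ((mul_le_mul_of_nonneg_right h₁ (by positivity)).trans hj), h₀, h₂, hj,
    Nat.find_spec hI, key _ hJ, key _ hI⟩

/-- The level is the inner product of the displacement with the midpoint. Its first term is
nonnegative, so the midpoint has height below `B`; hence both heights are `O(B)`. -/
theorem pairLaw_thinClass_le (J : ℕ) : pairLaw.real (thinClass J) ≤ 2 * (1 / 4) ^ J := by
  have hB : (0 : ℝ) < (1 / 2) ^ J := by positivity
  have h4 : ((1 : ℝ) / 4) ^ J = (1 / 2) ^ J * (1 / 2) ^ J := by rw [← mul_pow]; norm_num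
  set B : ℝ := (1 / 2) ^ J with hBdef
  refine (pairLaw_real_le_of_subset (a := 1) (b := 2 * B) (c := 1) (d := B) (by norm_num)
    (by positivity) (by norm_num) hB.le ?_).trans (by rw [h4]; linarith)
  rintro ⟨⟨x₁, x₂⟩, y₁, y₂⟩ ⟨h₀, h₁, h₂⟩ ⟨⟨hx₁, hx₁'⟩, hx₂, hx₂'⟩ ⟨⟨hy₁, hy₁'⟩, hy₂, hy₂'⟩
  simp only [bisectorLevel, ← hBdef] at *
  have e : (x₁ ^ 2 + x₂ ^ 2 - y₁ ^ 2 - y₂ ^ 2) / 2 =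
    (x₁ - y₁) * ((x₁ + y₁) / 2) + (x₂ - y₂) * ((x₂ + y₂) / 2) := by ring
  have h₃ : 0 ≤ (x₁ - y₁) * ((x₁ + y₁) / 2) := mul_nonneg h₀ (by linarith)
  have h₄ : (x₂ + y₂) / 2 < B := by
    refine lt_of_mul_lt_mul_left ?_ h₁.le
    linarith
  exact ⟨⟨h₀, by dsimp only; linarith⟩, ⟨hx₂, by dsimp only; linarith⟩, ⟨hy₁, hy₁'⟩, hy₂,
    by dsimp only; linarith⟩

/-- Again the midpoint has height `O(B)`, which bounds both heights. The level is then `O(B ^ 2)`,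
so the horizontal displacement is `O(B ^ 2 / A)`, while the abscissa of the second point is `O(A)`.
The factors `A` cancel in the product. -/
theorem pairLaw_capClass_le (i j : ℕ) :
    pairLaw.real (capClass i j) ≤ 128 * (1 / 16) ^ j := by
  rcases Nat.eq_zero_or_pos j with rfl | hj
  · exact measureReal_le_one.trans (by norm_num)
  have hB : (0 : ℝ) < (1 / 2) ^ j := by positivity
  have hA : (0 : ℝ) < (1 / 2) ^ i := by positivity
  have h16 : ((1 : ℝ) / 16) ^ j = ((1 / 2) ^ j) ^ 4 := by
    rw [← pow_mul, mul_comm, pow_mul]; norm_num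
  have hA1 : i = 0 → (1 / 2 : ℝ) ^ i = 1 := by rintro rfl; simp
  set B : ℝ := (1 / 2) ^ j with hBdef
  set A : ℝ := (1 / 2) ^ i with hAdef
  refine (pairLaw_real_le_of_subset (a := 8 * B ^ 2 / A) (b := 4 * B) (c := 2 * A) (d := 2 * B)
    (by positivity) (by positivity) (by positivity) (by positivity) ?_).trans
      (by rw [h16]; apply le_of_eq; field_simp; ring)
  rintro ⟨⟨x₁, x₂⟩, y₁, y₂⟩ ⟨h₀, h₁, -, h₂, h₃, h₄⟩ ⟨⟨hx₁, hx₁'⟩, hx₂, hx₂'⟩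
    ⟨⟨hy₁, hy₁'⟩, hy₂, hy₂'⟩
  simp only [bisectorLevel, ← hBdef, ← hAdef] at *
  replace h₃ := h₃ hj
  have e : (x₁ ^ 2 + x₂ ^ 2 - y₁ ^ 2 - y₂ ^ 2) / 2 =
    (x₁ - y₁) * ((x₁ + y₁) / 2) + (x₂ - y₂) * ((x₂ + y₂) / 2) := by ring
  have h₅ : 0 ≤ (x₁ - y₁) * ((x₁ + y₁) / 2) := mul_nonneg h₀ (by linarith)
  have h₅' : 0 ≤ (x₂ - y₂) * ((x₂ + y₂) / 2) := mul_nonneg h₁.le (by linarith)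
  have h₆ : (x₂ + y₂) / 2 < 2 * B := by
    refine lt_of_mul_lt_mul_left ?_ h₁.le
    linarith
  have h₇ : x₁ - y₁ ≤ 8 * B ^ 2 / A := by
    rw [le_div_iff₀ hA]
    have : (x₂ - y₂) * (2 * B) ≤ (4 * B) * (2 * B) :=
      mul_le_mul_of_nonneg_right (by linarith) (by linarith)
    linarith
  -- For `i = 0` the class gives no upper bound on the level in terms of `A`, but then `A = 1` and
  -- the square suffices.
  have h₈ : y₁ ≤ 2 * A := by
    rcases Nat.eq_zero_or_pos i with hi | hi
    · rw [hA1 hi]; linarith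
    · have h₉ := h₄ hi
      have hpos : 0 < x₁ - y₁ := by
        rcases h₀.eq_or_lt with h | h
        · rw [← h] at h₉ e
          linarith
        · exact h
      refine le_of_lt (lt_of_mul_lt_mul_left ?_ h₀)
      have : (x₁ - y₁) * y₁ ≤ (x₁ - y₁) * ((x₁ + y₁) / 2) :=
        mul_le_mul_of_nonneg_left (by linarith) h₀
      linarith
  exact ⟨⟨h₀, h₇⟩, ⟨hx₂, by dsimp only; linarith⟩, ⟨hy₁, h₈⟩, hy₂, by dsimp only; linarith⟩

/-- Pairs whose first point joins the group and defeats all pairs cutting the triangle with legs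
`A` and `B` off the corner at the origin. -/
def blockingBox (A B : ℝ) : Set ((ℝ × ℝ) × (ℝ × ℝ)) :=
  shearedBox (Set.Icc (B ^ 2 / (8 * A)) (B ^ 2 / (4 * A))) (Set.Icc (B / 4) (5 * B / 16))
    (Set.Ico (A / 16) (A / 8)) (Set.Icc 0 (B / 16))

theorem measurableSet_blockingBox (A B : ℝ) : MeasurableSet (blockingBox A B) :=
  measurableSet_shearedBox measurableSet_Icc measurableSet_Icc measurableSet_Ico measurableSet_Icc

theorem sq_div_four_le {A B : ℝ} (hB : 0 < B) (hBA : B ≤ A) : B ^ 2 / (4 * A) ≤ A / 4 := by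
  have hA : 0 < A := hB.trans_le hBA
  rw [div_le_div_iff₀ (by positivity) (by norm_num)]
  nlinarith

theorem pairLaw_blockingBox {A B : ℝ} (hB : 0 < B) (hBA : B ≤ A) (hA1 : A ≤ 1) :
    pairLaw.real (blockingBox A B) = B ^ 4 / 32768 := by
  have hA : 0 < A := hB.trans_le hBA
  have hs := sq_div_four_le hB hBA
  have hsub : blockingBox A B ⊆ coordSquare ×ˢ coordSquare := by
    rintro ⟨⟨x₁, x₂⟩, y₁, y₂⟩ ⟨⟨h₁, h₁'⟩, ⟨h₂, h₂'⟩, ⟨h₃, h₃'⟩, h₄, h₄'⟩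
    have : 0 ≤ B ^ 2 / (8 * A) := by positivity
    dsimp only at *
    refine ⟨⟨⟨?_, ?_⟩, ?_, ?_⟩, ⟨?_, ?_⟩, ?_, ?_⟩ <;> dsimp only <;> linarith
  rw [pairLaw_eq, measureReal_restrict_apply (measurableSet_blockingBox A B),
    Set.inter_eq_left.2 hsub, measureReal_def, blockingBox, volume_shearedBox measurableSet_Icc
    measurableSet_Icc measurableSet_Ico measurableSet_Icc]
  have e : B ^ 2 / (4 * A) - B ^ 2 / (8 * A) = B ^ 2 / (8 * A) := by field_simp; norm_num
  simp only [Real.volume_Icc, Real.volume_Ico, ENNReal.toReal_mul, e]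
  rw [ENNReal.toReal_ofReal (by positivity), ENNReal.toReal_ofReal (by linarith),
    ENNReal.toReal_ofReal (by linarith), ENNReal.toReal_ofReal (by linarith)]
  field_simp
  ring

/-- Both displacements of `p` are bounded by `c / A` and `c / B`, so every `z` preferring `p.1`
satisfies `z.1 / A + z.2 / B ≥ 1`. The constants of the box put `q.1` strictly inside this triangle,
and put the bisector of `q` inside it as well: its level is at most `B ^ 2 / 8`, while its
displacements are at least `B ^ 2 / (8 * A)` and `B / 8`. -/
theorem blockingBox_defeats {A B : ℝ} (hB : 0 < B) (hBA : B ≤ A) {p q : (ℝ × ℝ) × (ℝ × ℝ)}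
    (hq : q ∈ blockingBox A B) (hpB : (p.1.2 - p.2.2) * B ≤ bisectorLevel p)
    (hpA : (p.1.1 - p.2.1) * A ≤ bisectorLevel p) (hpos : 0 < p.1.2 - p.2.2) :
    ¬ Prefers q.1 p ∧
      ∀ z : ℝ × ℝ, 0 ≤ z.1 → 0 ≤ z.2 → Prefers z p → Prefers z q := by
  have hA : 0 < A := hB.trans_le hBA
  have hs := sq_div_four_le hB hBA
  obtain ⟨⟨x₁, x₂⟩, y₁, y₂⟩ := q
  obtain ⟨⟨h₁, h₁'⟩, ⟨h₂, h₂'⟩, ⟨h₃, h₃'⟩, h₄, h₄'⟩ := hq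
  unfold Prefers
  dsimp only at *
  set a := p.1.1 - p.2.1
  set b := p.1.2 - p.2.2
  set c := bisectorLevel p
  have hc : 0 < c := (mul_pos hpos hB).trans_le hpB
  have ha : a ≤ c / A := (le_div_iff₀ hA).2 hpA
  have hb : b ≤ c / B := (le_div_iff₀ hB).2 hpB
  have h0 : 0 ≤ B ^ 2 / (8 * A) := by positivity
  constructor
  · rw [not_le]
    -- The abscissa is at most `A / 8 + A / 4`, the second term bounding the displacement by
    -- `sq_div_four_le`.
    calc a * x₁ + b * x₂ ≤ c / A * (3 * A / 8) + c / B * (5 * B / 16) := by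
          have := div_pos hc hA
          have := div_pos hc hB
          have i₁ : a * x₁ ≤ c / A * (3 * A / 8) :=
            mul_le_mul ha (by linarith) (by linarith) (by positivity)
          have i₂ : b * x₂ ≤ c / B * (5 * B / 16) :=
            mul_le_mul hb h₂' (by linarith) (by positivity)
          linarith
      _ = c * (11 / 16) := by field_simp; norm_num
      _ < c := by linarith
  · intro z hz₁ hz₂ hz
    have hz' : 1 ≤ z.1 / A + z.2 / B := by
      have : c ≤ c * (z.1 / A + z.2 / B) := by
        calc c ≤ a * z.1 + b * z.2 := hz
          _ ≤ c / A * z.1 + c / B * z.2 := add_le_add (mul_le_mul_of_nonneg_right ha hz₁)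
              (mul_le_mul_of_nonneg_right hb hz₂)
          _ = _ := by ring
      nlinarith
    set u := x₁ - y₁ with hu
    set s := x₂ - y₂ with hs'
    have huA : B ^ 2 / 8 ≤ u * A := by
      have := mul_le_mul_of_nonneg_right h₁ hA.le
      have e : B ^ 2 / (8 * A) * A = B ^ 2 / 8 := by field_simp
      linarith
    have huA' : u * A ≤ B ^ 2 / 4 := by
      have := mul_le_mul_of_nonneg_right h₁' hA.le
      have e : B ^ 2 / (4 * A) * A = B ^ 2 / 4 := by field_simp
      linarith
    have hsB : B ^ 2 / 8 ≤ s * B := by nlinarith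
    have hlevel : bisectorLevel ((x₁, x₂), y₁, y₂) ≤ B ^ 2 / 8 := by
      have e : bisectorLevel ((x₁, x₂), y₁, y₂) = u * ((x₁ + y₁) / 2) + s * ((x₂ + y₂) / 2) := by
        simp only [bisectorLevel, hu, hs']; ring
      have i₁ : u * ((x₁ + y₁) / 2) ≤ u * (A / 4) :=
        mul_le_mul_of_nonneg_left (by linarith) (by linarith)
      have i₂ : s * ((x₂ + y₂) / 2) ≤ (5 * B / 16) * (3 * B / 16) :=
        mul_le_mul (by linarith) (by linarith) (by linarith) (by positivity)
      rw [e]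
      nlinarith
    calc bisectorLevel ((x₁, x₂), y₁, y₂) ≤ B ^ 2 / 8 * 1 := by linarith
      _ ≤ B ^ 2 / 8 * (z.1 / A + z.2 / B) := by gcongr
      _ ≤ u * A * (z.1 / A) + s * B * (z.2 / B) := by
          rw [mul_add]
          gcongr
      _ = u * z.1 + s * z.2 := by field_simp

/-- The pairs at all scales between `2⁻ʲ` and `2⁻ⁱ` which block the pairs in `capClass i j`. -/
def blockingSet (i j : ℕ) : Set ((ℝ × ℝ) × (ℝ × ℝ)) :=
  ⋃ m ∈ Finset.Icc i j, blockingBox ((1 / 2) ^ m) ((1 / 2) ^ j)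

theorem measurableSet_blockingSet (i j : ℕ) : MeasurableSet (blockingSet i j) :=
  Finset.measurableSet_biUnion _ fun _ _ => measurableSet_blockingBox _ _

theorem pairLaw_blockingSet {i j : ℕ} (hij : i ≤ j) :
    pairLaw.real (blockingSet i j) = ((j - i + 1 : ℕ) : ℝ) * ((1 / 16) ^ j / 32768) := by
  have h16 : ((1 : ℝ) / 16) ^ j = ((1 / 2) ^ j) ^ 4 := by
    rw [← pow_mul, mul_comm, pow_mul]; norm_num
  rw [blockingSet, measureReal_biUnion_finset]
  · rw [Finset.sum_congr rfl fun m hm => pairLaw_blockingBox (by positivity)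
      (pow_le_pow_of_le_one (by norm_num) (by norm_num) (Finset.mem_Icc.1 hm).2)
      (pow_le_one₀ (by norm_num) (by norm_num))]
    rw [Finset.sum_const, Nat.card_Icc, nsmul_eq_mul, h16]
    congr 2
    omega
  -- The half-open dyadic intervals for the abscissa of the second point make different scales
  -- disjoint.
  · have key : ∀ m m' : ℕ, m < m' →
        Disjoint (blockingBox ((1 / 2) ^ m) ((1 / 2) ^ j))
          (blockingBox ((1 / 2) ^ m') ((1 / 2) ^ j)) := by
      intro m m' h
      rw [Set.disjoint_left]
      intro p hp hp'
      have h₁ := hp.2.2.1.1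
      have h₂ := hp'.2.2.1.2
      have h₃ : (1 / 2 : ℝ) ^ m' ≤ (1 / 2) ^ (m + 1) :=
        pow_le_pow_of_le_one (by norm_num) (by norm_num) h
      rw [pow_succ] at h₃
      linarith
    intro m _ m' _ hne
    rcases lt_or_gt_of_ne hne with h | h
    exacts [key m m' h, (key m' m h).symm]
  · exact fun _ _ => measurableSet_blockingBox _ _

theorem blockingSet_defeats {i j : ℕ} {p q : (ℝ × ℝ) × (ℝ × ℝ)} (hp : p ∈ capClass i j)
    (hq : q ∈ blockingSet i j) :
    ¬ Prefers q.1 p ∧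
      ∀ z : ℝ × ℝ, 0 ≤ z.1 → 0 ≤ z.2 → Prefers z p → Prefers z q := by
  obtain ⟨h₀, h₁, h₂, h₃, -, -⟩ := hp
  simp only [blockingSet, Set.mem_iUnion, Finset.mem_Icc] at hq
  obtain ⟨m, ⟨hm, hm'⟩, hq⟩ := hq
  refine blockingBox_defeats (by positivity)
    (pow_le_pow_of_le_one (by norm_num) (by norm_num) hm') hq h₂ (le_trans ?_ h₃) h₁
  exact mul_le_mul_of_nonneg_left (pow_le_pow_of_le_one (by norm_num) (by norm_num) hm) h₀

end Plane

/-! ### Symmetries of the square and transfer to coordinates -/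

section Frames

/-- The symmetries of the unit square. -/
def squareSymm (g : Bool × Bool × Bool) (p : ℝ × ℝ) : ℝ × ℝ :=
  let q := (bif g.1 then 1 - p.1 else p.1, bif g.2.1 then 1 - p.2 else p.2)
  bif g.2.2 then q.swap else q

/-- The coordinates of a point of the plane, with respect to one of the corners of the unit square
and one of the orders of the axes. -/
def frame (g : Bool × Bool × Bool) (z : EuclideanSpace ℝ (Fin 2)) : ℝ × ℝ :=
  squareSymm g (z 0, z 1)

theorem squareSymm_mem_iff (g : Bool × Bool × Bool) (p : ℝ × ℝ) :
    squareSymm g p ∈ coordSquare ↔ p ∈ coordSquare := by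
  obtain ⟨a, b, s⟩ := g
  simp only [mem_coordSquare]
  cases a <;> cases b <;> cases s <;> simp [squareSymm] <;> tauto

theorem measurePreserving_squareSymm (g : Bool × Bool × Bool) :
    MeasurePreserving (squareSymm g) squareLaw squareLaw := by
  have h : MeasurePreserving (squareSymm g) volume volume := by
    obtain ⟨a, b, s⟩ := g
    have hr : ∀ a : Bool, MeasurePreserving (fun x : ℝ => bif a then 1 - x else x)
        volume volume := by
      intro a
      cases a
      · exact MeasurePreserving.id _
      · exact Measure.measurePreserving_sub_left volume 1
    have hp : MeasurePreserving (Prod.map (fun x : ℝ => bif a then 1 - x else x)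
        (fun x : ℝ => bif b then 1 - x else x)) (volume : Measure (ℝ × ℝ)) volume :=
      (hr a).prod (hr b)
    cases s
    · exact hp
    · exact Measure.measurePreserving_swap.comp hp
  have e : squareSymm g ⁻¹' coordSquare = coordSquare := by
    ext p; exact squareSymm_mem_iff g p
  have := h.restrict_preimage measurableSet_coordSquare
  rwa [e] at this

theorem mem_unitSquare_iff {z : EuclideanSpace ℝ (Fin 2)} :
    z ∈ unitSquare ↔ (z 0, z 1) ∈ coordSquare := by
  rw [mem_coordSquare]
  simp [unitSquare, Fin.forall_fin_two]

theorem frame_mem_coordSquare (g : Bool × Bool × Bool) {z : EuclideanSpace ℝ (Fin 2)}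
    (hz : z ∈ unitSquare) : frame g z ∈ coordSquare :=
  (squareSymm_mem_iff g _).2 (mem_unitSquare_iff.1 hz)

theorem measurePreserving_coords :
    MeasurePreserving (fun z : EuclideanSpace ℝ (Fin 2) => (z 0, z 1)) volume volume :=
  (volume_preserving_finTwoArrow ℝ).comp (PiLp.volume_preserving_ofLp (Fin 2))

theorem unitSquare_eq_preimage :
    unitSquare = (fun z : EuclideanSpace ℝ (Fin 2) => (z 0, z 1)) ⁻¹' coordSquare := by
  ext z; exact mem_unitSquare_iff

theorem measurableSet_unitSquare : MeasurableSet unitSquare := by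
  rw [unitSquare_eq_preimage]
  exact measurePreserving_coords.measurable measurableSet_coordSquare

theorem volume_unitSquare : volume unitSquare = 1 := by
  rw [unitSquare_eq_preimage, measurePreserving_coords.measure_preimage
    measurableSet_coordSquare.nullMeasurableSet, volume_coordSquare]

theorem cond_unitSquare :
    ProbabilityTheory.cond volume unitSquare = volume.restrict unitSquare := by
  rw [ProbabilityTheory.cond, volume_unitSquare, inv_one, one_smul]

theorem measurePreserving_frame (g : Bool × Bool × Bool) :
    MeasurePreserving (frame g) (volume.restrict unitSquare) squareLaw := by
  refine (measurePreserving_squareSymm g).comp ?_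
  have := measurePreserving_coords.restrict_preimage measurableSet_coordSquare
  rwa [← unitSquare_eq_preimage] at this

theorem measurable_frame (g : Bool × Bool × Bool) : Measurable (frame g) :=
  (measurePreserving_frame g).measurable

theorem dist_le_dist_iff_prefers (g : Bool × Bool × Bool) (z x y : EuclideanSpace ℝ (Fin 2)) :
    dist z x ≤ dist z y ↔ Prefers (frame g z) (frame g x, frame g y) := by
  rw [prefers_iff, EuclideanSpace.dist_eq, EuclideanSpace.dist_eq,
    Real.sqrt_le_sqrt_iff (by positivity)]
  simp only [Fin.sum_univ_two, Real.dist_eq, sq_abs, frame]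
  obtain ⟨a, b, s⟩ := g
  cases a <;> cases b <;> cases s <;> simp only [squareSymm, cond_true, cond_false, Prod.swap] <;>
    ring_nf

theorem votesFor_iff_prefers (g : Bool × Bool × Bool) {z : EuclideanSpace ℝ (Fin 2)}
    {c : Fin 2 → EuclideanSpace ℝ (Fin 2)} {j : Fin 2} :
    VotesFor z c j ↔ Prefers (frame g z) (frame g (c j), frame g (c j.rev)) := by
  rw [votesFor_iff_rev, dist_le_dist_iff_prefers g]

/-- Reflections turn both coordinate differences into absolute values; a swap then puts the smaller
one first. -/
theorem exists_squareSymm (x y : ℝ × ℝ) : ∃ g : Bool × Bool × Bool,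
    0 ≤ (squareSymm g x).1 - (squareSymm g y).1 ∧
      (squareSymm g x).1 - (squareSymm g y).1 ≤ (squareSymm g x).2 - (squareSymm g y).2 := by
  have hr : ∀ s t : ℝ, ∃ a : Bool,
      (bif a then 1 - s else s) - (bif a then 1 - t else t) = |s - t| := by
    intro s t
    rcases le_total 0 (s - t) with h | h
    · exact ⟨false, by simp [abs_of_nonneg h]⟩
    · exact ⟨true, by simp [abs_of_nonpos h]⟩
  obtain ⟨a, ha⟩ := hr x.1 y.1
  obtain ⟨b, hb⟩ := hr x.2 y.2
  rcases le_total |x.1 - y.1| |x.2 - y.2| with h | h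
  · refine ⟨(a, b, false), ?_⟩
    simp only [squareSymm, cond_false, ha, hb]
    exact ⟨abs_nonneg _, h⟩
  · refine ⟨(a, b, true), ?_⟩
    simp only [squareSymm, cond_true, Prod.swap, ha, hb]
    exact ⟨abs_nonneg _, h⟩

end Frames

/-! ### Effect of a blocking round on later elections -/

section Blocking

/-- A round whose pair lies in the blocking set makes every later candidate pair of the class
fail. -/
theorem not_unanimous_of_blocking (g : Bool × Bool × Bool) {i j : ℕ}
    {G₀ : Set (EuclideanSpace ℝ (Fin 2))} {c : ℕ → Fin 2 → EuclideanSpace ℝ (Fin 2)}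
    (h₀ : G₀ ⊆ unitSquare) (hc : ∀ t j, c t j ∈ unitSquare) {s t : ℕ} (hst : s < t) {l : Fin 2}
    (hs : (frame g (c s 0), frame g (c s 1)) ∈ blockingSet i j)
    (ht : (frame g (c t l), frame g (c t l.rev)) ∈ capClass i j) :
    ¬ Unanimous (socialGroup G₀ c t) (c t) l := by
  intro hU
  obtain ⟨hne, hvote⟩ := blockingSet_defeats ht hs
  have hP : ∀ z ∈ socialGroup G₀ c t, Prefers (frame g z) (frame g (c t l), frame g (c t l.rev)) :=
    fun z hz => (votesFor_iff_prefers g).1 (hU z hz)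
  -- Members at time `s` are still members at time `t`, so a unanimous vote at `t` forces a
  -- unanimous vote for the first candidate at `s`; this candidate is then a member who rejects the
  -- winner at `t`.
  refine hne (hP _ (socialGroup_mono G₀ c (Nat.succ_le_of_lt hst)
    (mem_socialGroup_succ.2 (Or.inr ⟨0, rfl, fun z hz => (votesFor_iff_prefers g).2 ?_⟩))))
  have hz' := frame_mem_coordSquare g (socialGroup_subset h₀ hc s hz)
  exact hvote _ hz'.1.1 hz'.2.1 (hP z (socialGroup_mono G₀ c hst.le hz))

end Blocking

/-! ### Independence of rounds and laws of candidate pairs -/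

section Independence

variable {Ω : Type*} [MeasurableSpace Ω] {P : Measure Ω} {k : ℕ}
  {v : Fin k → Ω → EuclideanSpace ℝ (Fin 2)} {w : ℕ → Fin 2 → Ω → EuclideanSpace ℝ (Fin 2)}

/-- Induction on `t`, splitting the two candidates of the last round from all earlier variables.
Both bounds use this form: a constraint on each earlier round and a different one on the final
round. -/
theorem measureReal_initial_inter_rounds (hv : ∀ i, Measurable (v i))
    (hw : ∀ t j, Measurable (w t j))
    (hi : iIndepFun (Sum.elim v fun p : ℕ × Fin 2 => w p.1 p.2) P)
    {C : Set (EuclideanSpace ℝ (Fin 2))} (hC : MeasurableSet C)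
    {B : ℕ → Set (EuclideanSpace ℝ (Fin 2) × EuclideanSpace ℝ (Fin 2))}
    (hB : ∀ s, MeasurableSet (B s)) (t : ℕ) :
    P.real {ω | (∀ i, v i ω ∈ C) ∧ ∀ s < t, (w s 0 ω, w s 1 ω) ∈ B s} =
      (∏ i, P.real {ω | v i ω ∈ C}) *
        ∏ s ∈ Finset.range t, P.real {ω | (w s 0 ω, w s 1 ω) ∈ B s} := by
  have hm : ∀ i, Measurable ((Sum.elim v fun p : ℕ × Fin 2 => w p.1 p.2) i) := by
    rintro (i | p)
    exacts [hv i, hw _ _]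
  induction t with
  | zero =>
    have h := (hi.precomp Sum.inl_injective).measure_inter_preimage_eq_mul Finset.univ
      (sets := fun _ => C) (fun _ _ => hC)
    simp only [Finset.range_zero, Finset.prod_empty, mul_one, not_lt_zero, false_imp_iff,
      implies_true, and_true, measureReal_def, ← ENNReal.toReal_prod]
    congr 1
    refine Eq.trans ?_ h
    congr 1
    ext ω
    simp
  | succ t ih =>
    rw [Finset.prod_range_succ, ← mul_assoc, ← ih]
    let S : Finset (Fin k ⊕ ℕ × Fin 2) :=
      Finset.univ.disjSum (Finset.range t ×ˢ Finset.univ)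
    let S' : Finset (Fin k ⊕ ℕ × Fin 2) := {Sum.inr (t, 0), Sum.inr (t, 1)}
    have hd : Disjoint S S' := by
      rw [Finset.disjoint_left]
      intro x hx hx'
      simp only [S', Finset.mem_insert, Finset.mem_singleton] at hx'
      rcases hx' with rfl | rfl <;> simp [S] at hx
    have hind := hi.indepFun_finset S S' hd hm
    have m₁ : ∀ i, Sum.inl i ∈ S := fun i => by simp [S]
    have m₂ : ∀ s (_ : s < t) j, Sum.inr (s, j) ∈ S := fun s hs j => by simp [S, hs]
    let D : Set (S → EuclideanSpace ℝ (Fin 2)) :=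
      {f | (∀ i, f ⟨Sum.inl i, m₁ i⟩ ∈ C) ∧ ∀ s (hs : s < t),
        (f ⟨Sum.inr (s, 0), m₂ s hs 0⟩, f ⟨Sum.inr (s, 1), m₂ s hs 1⟩) ∈ B s}
    let D' : Set (S' → EuclideanSpace ℝ (Fin 2)) :=
      {f | (f ⟨Sum.inr (t, 0), by simp [S']⟩, f ⟨Sum.inr (t, 1), by simp [S']⟩) ∈ B t}
    have hD : MeasurableSet D := by
      have e : D = (⋂ i, (fun f => f ⟨Sum.inl i, m₁ i⟩) ⁻¹' C) ∩ ⋂ s, ⋂ hs : s < t,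
          (fun f => (f ⟨Sum.inr (s, 0), m₂ s hs 0⟩, f ⟨Sum.inr (s, 1), m₂ s hs 1⟩)) ⁻¹' B s := by
        ext f
        simp [D]
      rw [e]
      refine MeasurableSet.inter (MeasurableSet.iInter fun i => (measurable_pi_apply _) hC)
        (MeasurableSet.iInter fun s => MeasurableSet.iInter fun hs => ?_)
      exact ((measurable_pi_apply _).prodMk (measurable_pi_apply _)) (hB s)
    have hD' : MeasurableSet D' :=
      ((measurable_pi_apply _).prodMk (measurable_pi_apply _)) (hB t)
    have := hind.measure_inter_preimage_eq_mul D D' hD hD'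
    simp only [measureReal_def, ← ENNReal.toReal_mul]
    congr 1
    refine Eq.trans (congrArg P ?_) this
    ext ω
    simp only [Set.mem_ofPred_eq, Set.mem_inter_iff, Set.mem_preimage, D, D', Sum.elim_inl,
      Sum.elim_inr]
    constructor
    · exact fun h => ⟨⟨h.1, fun s hs => h.2 s (by omega)⟩, h.2 t (by omega)⟩
    · rintro ⟨⟨h₁, h₂⟩, h₃⟩
      refine ⟨h₁, fun s hs => ?_⟩
      rcases Nat.lt_succ_iff_lt_or_eq.1 hs with h | rfl
      exacts [h₂ s h, h₃]

theorem map_frame_pair [IsProbabilityMeasure P] (hw : ∀ t j, Measurable (w t j))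
    (hu : ∀ t j, pdf.IsUniform (w t j) unitSquare P volume)
    (hi : iIndepFun (Sum.elim v fun p : ℕ × Fin 2 => w p.1 p.2) P)
    (g : Bool × Bool × Bool) (t : ℕ) (j : Fin 2) :
    P.map (fun ω => (frame g (w t j ω), frame g (w t j.rev ω))) = pairLaw := by
  have hne : (Sum.inr (t, j) : Fin k ⊕ ℕ × Fin 2) ≠ Sum.inr (t, j.rev) := by
    fin_cases j <;> simp
  have h := (hi.indepFun hne).comp (measurable_frame g) (measurable_frame g)
  have hf : ∀ j, Measurable fun ω => frame g (w t j ω) := fun j =>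
    (measurable_frame g).comp (hw t j)
  have h' : IndepFun (fun ω => frame g (w t j ω)) (fun ω => frame g (w t j.rev ω)) P := h
  rw [(indepFun_iff_map_prod_eq_prod_map_map (hf j).aemeasurable (hf j.rev).aemeasurable).1 h']
  have hl : ∀ j, P.map (fun ω => frame g (w t j ω)) = squareLaw := by
    intro j
    have e : P.map (w t j) = volume.restrict unitSquare := by
      rw [← cond_unitSquare]; exact hu t j
    rw [← (measurePreserving_frame g).map_eq, ← e, Measure.map_map (measurable_frame g) (hw t j)]
    rfl
  rw [hl, hl, pairLaw]

theorem measureReal_frame_pair [IsProbabilityMeasure P] (hw : ∀ t j, Measurable (w t j))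
    (hu : ∀ t j, pdf.IsUniform (w t j) unitSquare P volume)
    (hi : iIndepFun (Sum.elim v fun p : ℕ × Fin 2 => w p.1 p.2) P)
    (g : Bool × Bool × Bool) (t : ℕ) (j : Fin 2) {K : Set ((ℝ × ℝ) × (ℝ × ℝ))}
    (hK : MeasurableSet K) :
    P.real {ω | (frame g (w t j ω), frame g (w t j.rev ω)) ∈ K} = pairLaw.real K := by
  rw [← map_frame_pair hw hu hi g t j, map_measureReal_apply _ hK]
  · rfl
  · exact ((measurable_frame g).comp (hw t j)).prodMk ((measurable_frame g).comp (hw t j.rev))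

theorem ae_mem_unitSquare {Y : Ω → EuclideanSpace ℝ (Fin 2)} (hY : Measurable Y)
    (hu : pdf.IsUniform Y unitSquare P volume) : ∀ᵐ ω ∂P, Y ω ∈ unitSquare := by
  have e : P.map Y = volume.restrict unitSquare := by rw [← cond_unitSquare]; exact hu
  refine ae_of_ae_map hY.aemeasurable ?_
  rw [e]
  exact ae_restrict_mem measurableSet_unitSquare

theorem ae_forall_mem_unitSquare (hv : ∀ i, Measurable (v i)) (hw : ∀ t j, Measurable (w t j))
    (hvu : ∀ i, pdf.IsUniform (v i) unitSquare P volume)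
    (hu : ∀ t j, pdf.IsUniform (w t j) unitSquare P volume) :
    ∀ᵐ ω ∂P, (∀ i, v i ω ∈ unitSquare) ∧ ∀ t j, w t j ω ∈ unitSquare :=
  (ae_all_iff.2 fun i => ae_mem_unitSquare (hv i) (hvu i)).and
    (ae_all_iff.2 fun t => ae_all_iff.2 fun j => ae_mem_unitSquare (hw t j) (hu t j))

end Independence

/-! ### The upper bound -/

section UpperBound

variable {Ω : Type*} [MeasurableSpace Ω] {P : Measure Ω} [IsProbabilityMeasure P] {k : ℕ}
  {v : Fin k → Ω → EuclideanSpace ℝ (Fin 2)} {w : ℕ → Fin 2 → Ω → EuclideanSpace ℝ (Fin 2)}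

theorem measureReal_mono_ae_imp {p q : Ω → Prop} (h : ∀ᵐ ω ∂P, p ω → q ω) :
    P.real {ω | p ω} ≤ P.real {ω | q ω} :=
  ENNReal.toReal_mono (measure_ne_top _ _) (measure_mono_ae h)

theorem measureReal_capClass_unanimous_le (hv : ∀ i, Measurable (v i))
    (hw : ∀ t j, Measurable (w t j))
    (hvu : ∀ i, pdf.IsUniform (v i) unitSquare P volume)
    (hu : ∀ t j, pdf.IsUniform (w t j) unitSquare P volume)
    (hi : iIndepFun (Sum.elim v fun p : ℕ × Fin 2 => w p.1 p.2) P)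
    (g : Bool × Bool × Bool) (t : ℕ) (l : Fin 2) (i j : ℕ) :
    P.real {ω | (frame g (w t l ω), frame g (w t l.rev ω)) ∈ capClass i j ∧
        Unanimous (randomGroup v w t ω) (fun j => w t j ω) l} ≤
      pairLaw.real (capClass i j) * (1 - pairLaw.real (blockingSet i j)) ^ t := by
  have hf := measurable_frame g
  let K : Set (EuclideanSpace ℝ (Fin 2) × EuclideanSpace ℝ (Fin 2)) :=
    {z | (frame g (![z.1, z.2] l), frame g (![z.1, z.2] l.rev)) ∈ capClass i j}
  let Q : Set (EuclideanSpace ℝ (Fin 2) × EuclideanSpace ℝ (Fin 2)) :=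
    {z | (frame g z.1, frame g z.2) ∈ (blockingSet i j)ᶜ}
  have hl : ∀ l : Fin 2, Measurable fun z : EuclideanSpace ℝ (Fin 2) × EuclideanSpace ℝ (Fin 2) =>
      ![z.1, z.2] l := by
    intro l
    fin_cases l
    exacts [measurable_fst, measurable_snd]
  have hK : MeasurableSet K :=
    ((hf.comp (hl l)).prodMk (hf.comp (hl l.rev))) (measurableSet_capClass i j)
  have hQ : MeasurableSet Q :=
    ((hf.comp measurable_fst).prodMk (hf.comp measurable_snd))
      (measurableSet_blockingSet i j).compl
  -- Apart from a null event, a win in this class at round index `t` forces all `t` earlier pairs to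
  -- avoid the blocking set.
  have key := measureReal_initial_inter_rounds hv hw hi MeasurableSet.univ
    (B := fun s => if s = t then K else Q) (fun s => by split_ifs <;> assumption) (t + 1)
  have hwl : ∀ ω (l : Fin 2), ![w t 0 ω, w t 1 ω] l = w t l ω := by
    intro ω l
    fin_cases l <;> rfl
  have hKt : P.real {ω | (w t 0 ω, w t 1 ω) ∈ K} = pairLaw.real (capClass i j) := by
    rw [← measureReal_frame_pair hw hu hi g t l (measurableSet_capClass i j)]
    simp only [K, Set.mem_ofPred_eq, hwl]
  have hQs : ∀ s, P.real {ω | (w s 0 ω, w s 1 ω) ∈ Q} = 1 - pairLaw.real (blockingSet i j) := by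
    intro s
    rw [← probReal_compl_eq_one_sub (measurableSet_blockingSet i j),
      ← measureReal_frame_pair hw hu hi g s 0 (measurableSet_blockingSet i j).compl]
    rfl
  have hprod : ∏ s ∈ Finset.range (t + 1),
      P.real {ω | (w s 0 ω, w s 1 ω) ∈ if s = t then K else Q} =
      pairLaw.real (capClass i j) * (1 - pairLaw.real (blockingSet i j)) ^ t := by
    rw [Finset.prod_range_succ, mul_comm]
    simp only [if_true, hKt]
    congr 1
    rw [Finset.prod_congr rfl (g := fun _ => 1 - pairLaw.real (blockingSet i j)),
      Finset.prod_const, Finset.card_range]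
    intro s hs
    rw [if_neg (Finset.mem_range.1 hs).ne, hQs]
  rw [hprod] at key
  simp only [Set.mem_univ, Set.ofPred_true, probReal_univ, Finset.prod_const_one, one_mul] at key
  rw [← key]
  refine measureReal_mono_ae_imp ?_
  filter_upwards [ae_forall_mem_unitSquare hv hw hvu hu] with ω hω h
  refine ⟨fun _ => trivial, fun s hs => ?_⟩
  rcases Nat.lt_succ_iff_lt_or_eq.1 hs with h' | rfl
  · rw [if_neg h'.ne]
    intro hs'
    exact not_unanimous_of_blocking g (Set.range_subset_iff.2 hω.1) hω.2 h' hs' h.1 h.2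
  · rw [if_pos rfl]
    simp only [K, Set.mem_ofPred_eq, hwl]
    exact h.1

/-- A bound for the probability that a given candidate is elected unanimously in round `t + 1` and
that the bisector of the two candidates cuts off the corner selected by a given frame. -/
noncomputable def winBound (J t : ℕ) : ℝ :=
  2 * (1 / 4) ^ J + ∑ j ∈ Finset.range (J + 1), ∑ i ∈ Finset.range (j + 1),
    128 * (1 / 16) ^ j * (1 - ((j - i + 1 : ℕ) : ℝ) * ((1 / 16) ^ j / 32768)) ^ t

theorem measureReal_diagonal_eq_zero : pairLaw.real {p | p.1 = p.2} = 0 := by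
  refine le_antisymm ?_ measureReal_nonneg
  refine (pairLaw_real_le_of_subset (a := 0) (b := 1) (c := 1) (d := 1) le_rfl zero_le_one
    zero_le_one zero_le_one ?_).trans (by norm_num)
  rintro ⟨p, q⟩ (rfl : p = q) hp -
  exact ⟨by simp, hp.2, hp.1, hp.2⟩

theorem measureReal_unanimous_le (hv : ∀ i, Measurable (v i))
    (hw : ∀ t j, Measurable (w t j))
    (hvu : ∀ i, pdf.IsUniform (v i) unitSquare P volume)
    (hu : ∀ t j, pdf.IsUniform (w t j) unitSquare P volume)
    (hi : iIndepFun (Sum.elim v fun p : ℕ × Fin 2 => w p.1 p.2) P) (J t : ℕ) (l : Fin 2) :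
    P.real {ω | Unanimous (randomGroup v w t ω) (fun j => w t j ω) l} ≤ 8 * winBound J t := by
  let p : Bool × Bool × Bool → Ω → (ℝ × ℝ) × (ℝ × ℝ) := fun g ω =>
    (frame g (w t l ω), frame g (w t l.rev ω))
  let U : Ω → Prop := fun ω => Unanimous (randomGroup v w t ω) (fun j => w t j ω) l
  have hg : ∀ g, P.real ({ω | p g ω ∈ thinClass J} ∪ ⋃ j ∈ Finset.range (J + 1),
      ⋃ i ∈ Finset.range (j + 1), {ω | p g ω ∈ capClass i j ∧ U ω}) ≤ winBound J t := by
    intro g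
    refine (measureReal_union_le _ _).trans (add_le_add ?_ ?_)
    · rw [measureReal_frame_pair hw hu hi g t l (measurableSet_thinClass J)]
      exact pairLaw_thinClass_le J
    · refine (measureReal_biUnion_finset_le _ _).trans (Finset.sum_le_sum fun j _ => ?_)
      refine (measureReal_biUnion_finset_le _ _).trans (Finset.sum_le_sum fun i hi' => ?_)
      have hij : i ≤ j := Nat.lt_succ_iff.1 (Finset.mem_range.1 hi')
      refine (measureReal_capClass_unanimous_le hv hw hvu hu hi g t l i j).trans ?_
      rw [← pairLaw_blockingSet hij]
      have : 0 ≤ 1 - pairLaw.real (blockingSet i j) := sub_nonneg.2 measureReal_le_one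
      exact mul_le_mul_of_nonneg_right (pairLaw_capClass_le i j) (by positivity)
  -- Coinciding candidates must be discarded: the classes require a strictly positive second
  -- displacement.
  have hdiag : ∀ᵐ ω ∂P, p (false, false, false) ω ∉ {p | p.1 = p.2} := by
    have hm : MeasurableSet {p : (ℝ × ℝ) × (ℝ × ℝ) | p.1 = p.2} :=
      measurableSet_eq_fun measurable_fst measurable_snd
    have h := measureReal_frame_pair hw hu hi (false, false, false) t l hm
    rw [measureReal_diagonal_eq_zero, measureReal_eq_zero_iff] at h
    exact measure_eq_zero_iff_ae_notMem.1 h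
  calc P.real {ω | U ω}
      ≤ P.real {ω | ω ∈ ⋃ g, ({ω | p g ω ∈ thinClass J} ∪ ⋃ j ∈ Finset.range (J + 1),
          ⋃ i ∈ Finset.range (j + 1), {ω | p g ω ∈ capClass i j ∧ U ω})} := by
        refine measureReal_mono_ae_imp ?_
        filter_upwards [hdiag] with ω hω hU
        obtain ⟨g, h₀, h₁⟩ := exists_squareSymm (w t l ω 0, w t l ω 1)
          (w t l.rev ω 0, w t l.rev ω 1)
        have h₂ : 0 < (p g ω).1.2 - (p g ω).2.2 := by
          refine (h₀.trans h₁).lt_of_ne fun h => hω ?_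
          have e₂ : (p g ω).1.2 = (p g ω).2.2 := sub_eq_zero.1 h.symm
          have e₁ : (p g ω).1.1 = (p g ω).2.1 :=
            sub_eq_zero.1 (le_antisymm (h₁.trans_eq h.symm) h₀)
          obtain ⟨a, b, s⟩ := g
          simp only [p, frame] at e₁ e₂ ⊢
          cases a <;> cases b <;> cases s <;> simp [squareSymm] at e₁ e₂ ⊢ <;> tauto
        simp only [Set.mem_iUnion, Set.mem_union, Finset.mem_range, Set.mem_ofPred_eq]
        refine ⟨g, ?_⟩
        rcases exists_capClass_or_thinClass (p := p g ω) h₀ h₁ h₂ J with h | ⟨j, hj, i, hij, h⟩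
        · exact Or.inl h
        · exact Or.inr ⟨j, Nat.lt_succ_iff.2 hj, i, Nat.lt_succ_iff.2 hij, h, hU⟩
    _ ≤ ∑ g : Bool × Bool × Bool, winBound J t := by
        refine (measureReal_iUnion_fintype_le _).trans (Finset.sum_le_sum fun g _ => hg g)
    _ = 8 * winBound J t := by simp

theorem sum_one_sub_pow_le_inv {q : ℝ} (h₀ : 0 < q) (h₁ : q ≤ 1) (T : ℕ) :
    ∑ t ∈ Finset.range T, (1 - q) ^ t ≤ q⁻¹ := by
  have h := geom_sum_mul (1 - q) T
  have hp : 0 ≤ (1 - q) ^ T := pow_nonneg (by linarith) _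
  rw [← one_div, le_div_iff₀ h₀]
  linarith

theorem sum_winBound_le (J T : ℕ) :
    ∑ t ∈ Finset.range T, winBound J t ≤
      T * (2 * (1 / 4) ^ J) + 2 ^ 22 * ((J + 1) * (1 + Real.log (J + 1))) := by
  unfold winBound
  rw [Finset.sum_add_distrib, Finset.sum_const, Finset.card_range, nsmul_eq_mul]
  gcongr ?_ + ?_
  · exact le_rfl
  rw [Finset.sum_comm]
  have hj : ∀ j ∈ Finset.range (J + 1), ∑ t ∈ Finset.range T, ∑ i ∈ Finset.range (j + 1),
      128 * (1 / 16 : ℝ) ^ j * (1 - ((j - i + 1 : ℕ) : ℝ) * ((1 / 16) ^ j / 32768)) ^ t ≤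
      2 ^ 22 * (1 + Real.log (J + 1)) := by
    intro j hj
    rw [Finset.sum_comm]
    -- The geometric series cancels `16⁻ʲ` and leaves `128 * 32768 = 2 ^ 22`; reindexing by `j - i`
    -- then yields a harmonic number.
    calc _ ≤ ∑ i ∈ Finset.range (j + 1), 2 ^ 22 * ((j - i + 1 : ℕ) : ℝ)⁻¹ := by
          refine Finset.sum_le_sum fun i hi => ?_
          have hij : i ≤ j := Nat.lt_succ_iff.1 (Finset.mem_range.1 hi)
          rw [← Finset.mul_sum]
          have hq := pairLaw_blockingSet hij
          refine (mul_le_mul_of_nonneg_left (sum_one_sub_pow_le_inv (by positivity)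
            (hq ▸ measureReal_le_one) T) (by positivity)).trans_eq ?_
          have : ((j - i + 1 : ℕ) : ℝ) ≠ 0 := by positivity
          field_simp
          norm_num
      _ = 2 ^ 22 * ((harmonic (j + 1) : ℚ) : ℝ) := by
          rw [← Finset.mul_sum, harmonic, Rat.cast_sum, ← Finset.sum_range_reflect]
          congr 1
          refine Finset.sum_congr rfl fun i hi => ?_
          have hij : i ≤ j := Nat.lt_succ_iff.1 (Finset.mem_range.1 hi)
          push_cast
          congr 2
          norm_cast
          omega
      _ ≤ 2 ^ 22 * (1 + Real.log (J + 1)) := by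
          gcongr
          refine (harmonic_le_one_add_log _).trans ?_
          have : ((j + 1 : ℕ) : ℝ) ≤ J + 1 := by exact_mod_cast Finset.mem_range.1 hj
          gcongr
  refine (Finset.sum_le_sum hj).trans_eq ?_
  rw [Finset.sum_const, Finset.card_range, nsmul_eq_mul]
  push_cast
  ring

theorem integral_ncard_le (hv : ∀ i, Measurable (v i))
    (hw : ∀ t j, Measurable (w t j))
    (hvu : ∀ i, pdf.IsUniform (v i) unitSquare P volume)
    (hu : ∀ t j, pdf.IsUniform (w t j) unitSquare P volume)
    (hi : iIndepFun (Sum.elim v fun p : ℕ × Fin 2 => w p.1 p.2) P) (J T : ℕ) :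
    ∫ ω, ((randomGroup v w T ω).ncard : ℝ) ∂P ≤
      k + 16 * (T * (2 * (1 / 4) ^ J) + 2 ^ 22 * ((J + 1) * (1 + Real.log (J + 1)))) := by
  classical
  let U : ℕ → Fin 2 → Set Ω := fun t l =>
    {ω | Unanimous (randomGroup v w t ω) (fun j => w t j ω) l}
  have hU : ∀ t l, MeasurableSet (U t l) := measurableSet_unanimous hv hw
  have hint : ∀ t l, Integrable ((U t l).indicator fun _ => (1 : ℝ)) P := fun t l =>
    (integrable_const 1).indicator (hU t l)
  calc ∫ ω, ((randomGroup v w T ω).ncard : ℝ) ∂P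
      ≤ ∫ ω, (k + ∑ t ∈ Finset.range T, ∑ l, (U t l).indicator (fun _ => (1 : ℝ)) ω) ∂P := by
        refine integral_mono (integrable_ncard_randomGroup P hv hw T)
          ((integrable_const _).add (integrable_finsetSum _ fun t _ =>
            integrable_finsetSum _ fun l _ => hint t l)) fun ω => ?_
        have h : ((randomGroup v w T ω).ncard : ℝ) ≤ _ :=
          Nat.cast_le.2 (ncard_randomGroup_le v w T ω)
        refine h.trans_eq ?_
        push_cast
        rfl
    _ = k + ∑ t ∈ Finset.range T, ∑ l, P.real (U t l) := by
        rw [integral_add (integrable_const _) (integrable_finsetSum _ fun t _ =>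
          integrable_finsetSum _ fun l _ => hint t l), integral_finsetSum _ fun t _ =>
          integrable_finsetSum _ fun l _ => hint t l]
        congr 1
        · simp
        · refine Finset.sum_congr rfl fun t _ => ?_
          rw [integral_finsetSum _ fun l _ => hint t l]
          exact Finset.sum_congr rfl fun l _ => integral_indicator_one (hU t l)
    -- Two candidates and eight frames give the factor 16.
    _ ≤ k + ∑ t ∈ Finset.range T, 16 * winBound J t := by
        gcongr with t _
        rw [Fin.sum_univ_two]
        have h₀ := measureReal_unanimous_le hv hw hvu hu hi J t 0
        have h₁ := measureReal_unanimous_le hv hw hvu hu hi J t 1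
        linarith
    _ ≤ _ := by
        rw [← Finset.mul_sum]
        gcongr
        exact sum_winBound_le J T

end UpperBound

/-! ### Choice of the finest scale and of the constant -/

theorem exists_forall_le_mul_log_mul_log_log (k : ℕ) : ∃ C : ℝ, 0 < C ∧ ∀ T : ℕ, 3 ≤ T → ∃ J : ℕ,
    k + 16 * (T * (2 * (1 / 4) ^ J) + 2 ^ 22 * ((J + 1) * (1 + Real.log (J + 1)))) ≤
      C * (Real.log T * Real.log (Real.log T)) := by
  have h3 : 1 < Real.log 3 := by
    rw [Real.lt_log_iff_exp_lt (by norm_num)]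
    exact Real.exp_one_lt_three
  set δ := Real.log (Real.log 3) with hδ
  have hδ0 : 0 < δ := Real.log_pos h3
  have hlog4 : 0 < Real.log 4 := Real.log_pos (by norm_num)
  -- Division by `δ = ln ln 3` absorbs additive constants, since `ln ln T ≥ δ` for `T ≥ 3`. The
  -- power `2 ^ 28` is `16 * 2 ^ 22 * 4`, the last factor coming from `J + 1 ≤ 4 * L`.
  refine ⟨(k + 32) / δ + 2 ^ 28 * ((1 + Real.log 4) / δ + 1), by positivity, fun T hT => ?_⟩
  -- The least `J` with `T ≤ 2 ^ J`: it makes `T * (1 / 4) ^ J` at most 1 while `J` remains `O(ln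
  -- T)`.
  refine ⟨Nat.clog 2 T, ?_⟩
  set J := Nat.clog 2 T with hJ
  set L := Real.log T with hL
  have hT3 : (3 : ℝ) ≤ T := by exact_mod_cast hT
  have hL3 : Real.log 3 ≤ L := Real.log_le_log (by norm_num) hT3
  have hL1 : 1 < L := h3.trans_le hL3
  have hδL : δ ≤ Real.log L := Real.log_le_log (by linarith) hL3
  have hTJ : (T : ℝ) ≤ 2 ^ J := by exact_mod_cast Nat.le_pow_clog (by norm_num) T
  have hthin : (T : ℝ) * (2 * (1 / 4) ^ J) ≤ 2 := by
    have h4 : ((1 : ℝ) / 4) ^ J = (1 / 2) ^ J * (1 / 2) ^ J := by rw [← mul_pow]; norm_num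
    have h1 : (T : ℝ) * (1 / 2) ^ J ≤ 1 := by
      calc (T : ℝ) * (1 / 2) ^ J ≤ 2 ^ J * (1 / 2) ^ J := by gcongr
        _ = 1 := by rw [← mul_pow]; norm_num
    have h2 : ((1 : ℝ) / 2) ^ J ≤ 1 := pow_le_one₀ (by norm_num) (by norm_num)
    have h0 : (0 : ℝ) ≤ (1 / 2) ^ J := by positivity
    rw [h4]
    nlinarith
  have hJL : (J : ℝ) + 1 ≤ 4 * L := by
    have hlt : (2 : ℝ) ^ (J - 1) < T := by
      exact_mod_cast Nat.pow_pred_clog_lt_self (by norm_num) (by omega)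
    have hJ1 : 1 ≤ J := Nat.clog_pos (by norm_num) (by omega)
    have := Real.log_lt_log (by positivity) hlt
    rw [Real.log_pow, Nat.cast_sub hJ1, Nat.cast_one] at this
    have hl2 := Real.log_two_gt_d9
    have : ((J : ℝ) - 1) * (1 / 2) ≤ ((J : ℝ) - 1) * Real.log 2 :=
      mul_le_mul_of_nonneg_left (by linarith) (sub_nonneg.2 (by exact_mod_cast hJ1))
    linarith
  have hlogJ : 1 + Real.log (J + 1) ≤ ((1 + Real.log 4) / δ + 1) * Real.log L := by
    have h1 : Real.log (J + 1) ≤ Real.log 4 + Real.log L := by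
      rw [← Real.log_mul (by norm_num) (by linarith)]
      exact Real.log_le_log (by positivity) hJL
    have h2 : 1 + Real.log 4 ≤ (1 + Real.log 4) / δ * Real.log L := by
      rw [div_mul_eq_mul_div, le_div_iff₀ hδ0]
      gcongr
    linarith
  have hmain : ((J : ℝ) + 1) * (1 + Real.log (J + 1)) ≤
      4 * L * (((1 + Real.log 4) / δ + 1) * Real.log L) :=
    mul_le_mul hJL hlogJ (add_nonneg zero_le_one (Real.log_nonneg (by simp))) (by linarith)
  have hk : (k : ℝ) + 32 ≤ (k + 32) / δ * (L * Real.log L) := by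
    rw [div_mul_eq_mul_div, le_div_iff₀ hδ0]
    gcongr
    nlinarith
  have e : (2 : ℝ) ^ 28 = 16 * (2 ^ 22 * 4) := by norm_num
  rw [add_mul, e]
  nlinarith

/-! ### The lower bound -/

section LowerBound

/-- With `a = z - x` and `p = y - x`, the preference says that the sum of `2 * a * p - p ^ 2` over
the two coordinates is at most 0. Each term is at least `-2.1 * ε`, and at least `0.6 * p` when `p ≥
0`; hence `p ≤ 3.5 * ε` in each coordinate. -/
theorem le_of_prefers_of_near_corner {ε : ℝ} (hε₀ : 0 < ε) (hε : ε ≤ 1 / 10) {x y z : ℝ × ℝ}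
    (hx : x ∈ coordSquare) (hy : y ∈ coordSquare) (hx₁ : x.1 < ε) (hx₂ : x.2 < ε)
    (hz : z ∈ Set.Icc (9 / 10 : ℝ) 1 ×ˢ Set.Icc (9 / 10 : ℝ) 1) (h : Prefers z (x, y)) :
    y.1 ≤ 5 * ε ∧ y.2 ≤ 5 * ε := by
  obtain ⟨x₁, x₂⟩ := x
  obtain ⟨y₁, y₂⟩ := y
  obtain ⟨z₁, z₂⟩ := z
  obtain ⟨⟨a₁, a₂⟩, a₃, a₄⟩ := hx
  obtain ⟨⟨b₁, b₂⟩, b₃, b₄⟩ := hy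
  obtain ⟨⟨c₁, c₂⟩, c₃, c₄⟩ := hz
  rw [prefers_iff] at h
  dsimp only at *
  have lower : ∀ a p : ℝ, 8 / 10 ≤ a → a ≤ 1 → -ε ≤ p → p ≤ 1 →
      -(21 / 10) * ε ≤ 2 * a * p - p ^ 2 ∧ (6 / 10 * p ≤ 2 * a * p - p ^ 2 ∨ p ≤ 0) := by
    intro a p h₁ h₂ h₃ h₄
    rcases le_total 0 p with hp | hp
    · have : 6 / 10 * p ≤ 2 * a * p - p ^ 2 := by nlinarith
      exact ⟨by nlinarith, Or.inl this⟩
    · refine ⟨?_, Or.inr hp⟩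
      nlinarith
  obtain ⟨l₁, l₁'⟩ := lower (z₁ - x₁) (y₁ - x₁) (by linarith) (by linarith) (by linarith)
    (by linarith)
  obtain ⟨l₂, l₂'⟩ := lower (z₂ - x₂) (y₂ - x₂) (by linarith) (by linarith) (by linarith)
    (by linarith)
  have hsum : 2 * (z₁ - x₁) * (y₁ - x₁) - (y₁ - x₁) ^ 2 +
      (2 * (z₂ - x₂) * (y₂ - x₂) - (y₂ - x₂) ^ 2) ≤ 0 := by linarith
  constructor
  · rcases l₁' with h' | h' <;> linarith
  · rcases l₂' with h' | h' <;> linarith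

/-- If the initial members are all near `(1, 1)` and no round has both candidates near the origin,
then the group stays away from the origin. -/
theorem socialGroup_avoids_corner {ε : ℝ} (hε₀ : 0 < ε) (hε : ε ≤ 1 / 10)
    {G₀ : Set (EuclideanSpace ℝ (Fin 2))} {c : ℕ → Fin 2 → EuclideanSpace ℝ (Fin 2)}
    (g : Bool × Bool × Bool) (hne : G₀.Nonempty)
    (h₀ : ∀ z ∈ G₀, frame g z ∈ Set.Icc (9 / 10 : ℝ) 1 ×ˢ Set.Icc (9 / 10 : ℝ) 1)
    (hc : ∀ t j, c t j ∈ unitSquare) {t : ℕ}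
    (hbad : ∀ s < t, (frame g (c s 0), frame g (c s 1)) ∉
      (Set.Icc 0 (5 * ε) ×ˢ Set.Icc 0 (5 * ε)) ×ˢ (Set.Icc 0 (5 * ε) ×ˢ Set.Icc 0 (5 * ε))) :
    ∀ z ∈ socialGroup G₀ c t, ¬ ((frame g z).1 < ε ∧ (frame g z).2 < ε) := by
  induction t with
  | zero =>
    intro z hz h
    have := (h₀ z hz).1.1
    linarith [h.1]
  | succ t ih =>
    intro z hz h
    rcases mem_socialGroup_succ.1 hz with hz | ⟨l, rfl, hU⟩
    · exact ih (fun s hs => hbad s (hs.trans t.lt_succ_self)) z hz h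
    obtain ⟨y, hy⟩ := hne
    have hP := (votesFor_iff_prefers g).1 (hU y (socialGroup_mono G₀ c (Nat.zero_le t) hy))
    have hx := frame_mem_coordSquare g (hc t l)
    have hx' := frame_mem_coordSquare g (hc t l.rev)
    obtain ⟨h₁, h₂⟩ := le_of_prefers_of_near_corner hε₀ hε hx hx' h.1 h.2 (h₀ y hy) hP
    have m : frame g (c t l) ∈ Set.Icc 0 (5 * ε) ×ˢ Set.Icc 0 (5 * ε) :=
      ⟨⟨hx.1.1, by linarith [h.1]⟩, hx.2.1, by linarith [h.2]⟩
    have m' : frame g (c t l.rev) ∈ Set.Icc 0 (5 * ε) ×ˢ Set.Icc 0 (5 * ε) :=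
      ⟨⟨hx'.1.1, h₁⟩, hx'.2.1, h₂⟩
    refine hbad t t.lt_succ_self ?_
    fin_cases l
    exacts [⟨m, m'⟩, ⟨m', m⟩]

/-- The displacement is at least `ε / 16` in each coordinate and the level at most `ε ^ 2 / 16`,
while a point outside the corner has coordinate sum at least `ε`. -/
theorem prefers_of_far_from_corner {ε : ℝ} (hε₀ : 0 < ε) {x y z : ℝ × ℝ}
    (hx : x ∈ Set.Icc (ε / 8) (ε / 4) ×ˢ Set.Icc (ε / 8) (ε / 4))
    (hy : y ∈ Set.Icc 0 (ε / 16) ×ˢ Set.Icc 0 (ε / 16)) (hz : z ∈ coordSquare)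
    (h : ¬ (z.1 < ε ∧ z.2 < ε)) : Prefers z (x, y) := by
  obtain ⟨x₁, x₂⟩ := x
  obtain ⟨y₁, y₂⟩ := y
  obtain ⟨z₁, z₂⟩ := z
  obtain ⟨⟨a₁, a₂⟩, a₃, a₄⟩ := hx
  obtain ⟨⟨b₁, b₂⟩, b₃, b₄⟩ := hy
  obtain ⟨⟨c₁, -⟩, c₃, -⟩ := hz
  unfold Prefers bisectorLevel
  dsimp only at *
  have hl : (x₁ ^ 2 + x₂ ^ 2 - y₁ ^ 2 - y₂ ^ 2) / 2 ≤ ε / 16 * ε := by nlinarith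
  have h₁ : ε / 16 * z₁ ≤ (x₁ - y₁) * z₁ := mul_le_mul_of_nonneg_right (by linarith) c₁
  have h₂ : ε / 16 * z₂ ≤ (x₂ - y₂) * z₂ := mul_le_mul_of_nonneg_right (by linarith) c₃
  have hs : ε ≤ z₁ + z₂ := by
    by_contra hs
    exact h ⟨by linarith, by linarith⟩
  nlinarith

theorem squareLaw_real_box {a b : ℝ} (ha : 0 ≤ a) (hab : a ≤ b) (hb : b ≤ 1) :
    squareLaw.real (Set.Icc a b ×ˢ Set.Icc a b) = (b - a) ^ 2 := by
  have hsub : Set.Icc a b ×ˢ Set.Icc a b ⊆ coordSquare := fun p hp =>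
    ⟨⟨ha.trans hp.1.1, hp.1.2.trans hb⟩, ha.trans hp.2.1, hp.2.2.trans hb⟩
  rw [squareLaw, measureReal_restrict_apply (measurableSet_Icc.prod measurableSet_Icc),
    Set.inter_eq_left.2 hsub, measureReal_def, Measure.volume_eq_prod, Measure.prod_prod,
    Real.volume_Icc, ENNReal.toReal_mul, ENNReal.toReal_ofReal (sub_nonneg.2 hab), sq]

variable {Ω : Type*} [MeasurableSpace Ω] {P : Measure Ω} [IsProbabilityMeasure P] {k : ℕ}
  {v : Fin k → Ω → EuclideanSpace ℝ (Fin 2)} {w : ℕ → Fin 2 → Ω → EuclideanSpace ℝ (Fin 2)}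

/-- The event that the initial members are near `(1, 1)`, that no round before `t` has both
candidates at distance of order `ε` from the origin, and that the first candidate of round `t` is
then bound to win near the origin. -/
def cornerEvent (v : Fin k → Ω → EuclideanSpace ℝ (Fin 2))
    (w : ℕ → Fin 2 → Ω → EuclideanSpace ℝ (Fin 2)) (ε : ℝ) (t : ℕ) : Set Ω :=
  {ω | (∀ i, v i ω ∈ frame (false, false, false) ⁻¹'
      (Set.Icc (9 / 10 : ℝ) 1 ×ˢ Set.Icc (9 / 10 : ℝ) 1)) ∧
    ∀ s < t + 1, (w s 0 ω, w s 1 ω) ∈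
      Prod.map (frame (false, false, false)) (frame (false, false, false)) ⁻¹'
        (if s = t then (Set.Icc (ε / 8) (ε / 4) ×ˢ Set.Icc (ε / 8) (ε / 4)) ×ˢ
            (Set.Icc 0 (ε / 16) ×ˢ Set.Icc 0 (ε / 16))
          else ((Set.Icc 0 (5 * ε) ×ˢ Set.Icc 0 (5 * ε)) ×ˢ
            (Set.Icc 0 (5 * ε) ×ˢ Set.Icc 0 (5 * ε)))ᶜ)}

theorem measurableSet_cornerEvent_factor (ε : ℝ) (s t : ℕ) :
    MeasurableSet (if s = t then (Set.Icc (ε / 8) (ε / 4) ×ˢ Set.Icc (ε / 8) (ε / 4)) ×ˢ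
        (Set.Icc 0 (ε / 16) ×ˢ Set.Icc 0 (ε / 16))
      else ((Set.Icc 0 (5 * ε) ×ˢ Set.Icc 0 (5 * ε)) ×ˢ
        (Set.Icc 0 (5 * ε) ×ˢ Set.Icc 0 (5 * ε)))ᶜ) := by
  have h : ∀ a b : ℝ, MeasurableSet (Set.Icc a b ×ˢ Set.Icc a b) := fun a b =>
    measurableSet_Icc.prod measurableSet_Icc
  split_ifs
  · exact (h _ _).prod (h _ _)
  · exact ((h _ _).prod (h _ _)).compl

theorem measurableSet_cornerEvent (hv : ∀ i, Measurable (v i)) (hw : ∀ t j, Measurable (w t j))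
    (ε : ℝ) (t : ℕ) : MeasurableSet (cornerEvent v w ε t) := by
  have hf := measurable_frame (false, false, false)
  have hC : MeasurableSet (Set.Icc (9 / 10 : ℝ) 1 ×ˢ Set.Icc (9 / 10 : ℝ) 1) :=
    measurableSet_Icc.prod measurableSet_Icc
  rw [cornerEvent, Set.ofPred_and, Set.ofPred_forall, Set.ofPred_forall]
  refine MeasurableSet.inter (MeasurableSet.iInter fun i => (hf.comp (hv i)) hC)
    (MeasurableSet.iInter fun s => ?_)
  rw [Set.ofPred_forall]
  exact MeasurableSet.iInter fun _ => ((hf.prodMap hf).comp ((hw s 0).prodMk (hw s 1)))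
    (measurableSet_cornerEvent_factor ε s t)

theorem le_measureReal_cornerEvent (hv : ∀ i, Measurable (v i))
    (hw : ∀ t j, Measurable (w t j))
    (hvu : ∀ i, pdf.IsUniform (v i) unitSquare P volume)
    (hu : ∀ t j, pdf.IsUniform (w t j) unitSquare P volume)
    (hi : iIndepFun (Sum.elim v fun p : ℕ × Fin 2 => w p.1 p.2) P) {ε : ℝ} (hε₀ : 0 < ε)
    (hε : ε ≤ 1 / 10) (t : ℕ) :
    (1 / 100) ^ k * ((1 - 625 * ε ^ 4) ^ t * (ε ^ 4 / 16384)) ≤ P.real (cornerEvent v w ε t) := by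
  have hf := measurable_frame (false, false, false)
  have hC : MeasurableSet (Set.Icc (9 / 10 : ℝ) 1 ×ˢ Set.Icc (9 / 10 : ℝ) 1) :=
    measurableSet_Icc.prod measurableSet_Icc
  have hbox : ∀ a b : ℝ, MeasurableSet (Set.Icc a b ×ˢ Set.Icc a b) := fun a b =>
    measurableSet_Icc.prod measurableSet_Icc
  rw [cornerEvent, measureReal_initial_inter_rounds hv hw hi (hf hC)
    (fun s => (hf.prodMap hf) (measurableSet_cornerEvent_factor ε s t)), Finset.prod_range_succ]
  have hvi : ∀ i, P.real {ω | v i ω ∈ frame (false, false, false) ⁻¹'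
      (Set.Icc (9 / 10 : ℝ) 1 ×ˢ Set.Icc (9 / 10 : ℝ) 1)} = 1 / 100 := by
    intro i
    have e : P.map (v i) = volume.restrict unitSquare := by rw [← cond_unitSquare]; exact hvu i
    have h := squareLaw_real_box (a := 9 / 10) (b := 1) (by norm_num) (by norm_num) le_rfl
    rw [← (measurePreserving_frame (false, false, false)).map_eq, ← e,
      Measure.map_map hf (hv i), map_measureReal_apply (hf.comp (hv i)) hC] at h
    refine Eq.trans ?_ (h.trans (by norm_num))
    rfl
  rw [Finset.prod_congr rfl fun i _ => hvi i, Finset.prod_const, Finset.card_univ,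
    Fintype.card_fin]
  refine mul_le_mul_of_nonneg_left ?_ (by positivity)
  have hlaw : ∀ s (K : Set ((ℝ × ℝ) × (ℝ × ℝ))), MeasurableSet K →
      P.real {ω | (w s 0 ω, w s 1 ω) ∈
        Prod.map (frame (false, false, false)) (frame (false, false, false)) ⁻¹' K} =
      pairLaw.real K := fun s K hK => measureReal_frame_pair hw hu hi _ s 0 hK
  have h4 : 0 ≤ 1 - 625 * ε ^ 4 := by
    have : ε ^ 4 ≤ (1 / 10) ^ 4 := by gcongr
    linarith
  -- The `t` earlier rounds avoid a set of probability `(5 * ε) ^ 4`; the last round hits one of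
  -- probability `(ε / 8) ^ 2 * (ε / 16) ^ 2`.
  refine mul_le_mul ?_ ?_ (by positivity) (Finset.prod_nonneg fun _ _ => measureReal_nonneg)
  · rw [← Finset.card_range t, ← Finset.prod_const]
    rw [Finset.card_range]
    refine Finset.prod_le_prod (fun _ _ => h4) fun s hs => ?_
    rw [if_neg (Finset.mem_range.1 hs).ne, hlaw _ _ ((hbox _ _).prod (hbox _ _)).compl,
      probReal_compl_eq_one_sub ((hbox _ _).prod (hbox _ _)), pairLaw, measureReal_prod_prod,
      squareLaw_real_box le_rfl (by positivity) (by linarith)]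
    apply le_of_eq
    ring
  · rw [if_pos rfl, hlaw _ _ ((hbox _ _).prod (hbox _ _)), pairLaw, measureReal_prod_prod,
      squareLaw_real_box (by positivity) (by linarith) (by linarith),
      squareLaw_real_box le_rfl (by positivity) (by linarith)]
    apply le_of_eq
    ring

theorem ncard_add_one_le_of_mem_cornerEvent {Ω : Type*} {v : Fin k → Ω → EuclideanSpace ℝ (Fin 2)}
    {w : ℕ → Fin 2 → Ω → EuclideanSpace ℝ (Fin 2)} (hk : 1 ≤ k) {ε : ℝ} (hε₀ : 0 < ε)
    (hε : ε ≤ 1 / 10)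
    {t : ℕ} {ω : Ω} (hω : ω ∈ cornerEvent v w ε t) (hvω : ∀ i, v i ω ∈ unitSquare)
    (hwω : ∀ t j, w t j ω ∈ unitSquare) :
    (randomGroup v w t ω).ncard + 1 ≤ (randomGroup v w (t + 1) ω).ncard := by
  obtain ⟨h₁, h₂⟩ := hω
  have hfar : ∀ z ∈ randomGroup v w t ω, _ := socialGroup_avoids_corner hε₀ hε
    (G₀ := Set.range fun i => v i ω) (c := fun t j => w t j ω) (t := t) (false, false, false)
    ⟨v ⟨0, hk⟩ ω, Set.mem_range_self _⟩ (by rintro _ ⟨i, rfl⟩; exact h₁ i) hwω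
    fun s hs => by
      have := h₂ s (by omega)
      rw [if_neg hs.ne] at this
      exact this
  have hgood := h₂ t t.lt_succ_self
  rw [if_pos rfl] at hgood
  obtain ⟨hx, hy⟩ := hgood
  have hsub : randomGroup v w t ω ⊆ unitSquare :=
    socialGroup_subset (Set.range_subset_iff.2 hvω) hwω t
  refine ncard_add_one_le_consensusStep (c := fun j => w t j ω) (randomGroup_finite v w t ω)
    (fun z hz => (votesFor_iff_prefers (false, false, false)).2 ?_) fun hmem => ?_
  · exact prefers_of_far_from_corner hε₀ hx hy (frame_mem_coordSquare _ (hsub hz)) (hfar z hz)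
  · refine hfar _ hmem ⟨lt_of_le_of_lt hx.1.2 ?_, lt_of_le_of_lt hx.2.2 ?_⟩ <;> linarith

/-- The scale at which the corner is unlikely to be hit within `t` rounds. -/
noncomputable def cornerScale (t : ℕ) : ℝ := (√√(t : ℝ))⁻¹ / 10

theorem cornerScale_pos {t : ℕ} (ht : 1 ≤ t) : 0 < cornerScale t := by
  have : (0 : ℝ) < t := by exact_mod_cast ht
  unfold cornerScale; positivity

theorem cornerScale_le {t : ℕ} (ht : 1 ≤ t) : cornerScale t ≤ 1 / 10 := by
  have h : (1 : ℝ) ≤ √√(t : ℝ) :=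
    Real.one_le_sqrt.2 (Real.one_le_sqrt.2 (by exact_mod_cast ht))
  unfold cornerScale
  linarith [inv_le_one_of_one_le₀ h]

theorem cornerScale_pow_four (t : ℕ) : cornerScale t ^ 4 = (t : ℝ)⁻¹ / 10000 := by
  have h : √√(t : ℝ) ^ 4 = t := by
    rw [show 4 = 2 * 2 from rfl, pow_mul, Real.sq_sqrt (Real.sqrt_nonneg _),
      Real.sq_sqrt (Nat.cast_nonneg _)]
  rw [cornerScale, div_pow, inv_pow, h]
  norm_num

/-- The factor in the logarithmic lower bound. -/
noncomputable def lowerConst (k : ℕ) : ℝ := (1 / 100) ^ k / 2 / 163840000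

theorem lowerConst_pos (k : ℕ) : 0 < lowerConst k := by unfold lowerConst; positivity

/-- At this scale `625 * ε ^ 4 * t = 1 / 16`, so Bernoulli's inequality keeps the avoidance factor
above `1 / 2`, and the remaining factor is a multiple of `1 / t`. -/
theorem lowerConst_div_le_measureReal (hv : ∀ i, Measurable (v i))
    (hw : ∀ t j, Measurable (w t j))
    (hvu : ∀ i, pdf.IsUniform (v i) unitSquare P volume)
    (hu : ∀ t j, pdf.IsUniform (w t j) unitSquare P volume)
    (hi : iIndepFun (Sum.elim v fun p : ℕ × Fin 2 => w p.1 p.2) P) {t : ℕ} (ht : 1 ≤ t) :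
    lowerConst k * (t : ℝ)⁻¹ ≤ P.real (cornerEvent v w (cornerScale t) t) := by
  refine le_trans ?_ (le_measureReal_cornerEvent hv hw hvu hu hi (cornerScale_pos ht)
    (cornerScale_le ht) t)
  have ht' : (1 : ℝ) ≤ t := by exact_mod_cast ht
  rw [cornerScale_pow_four]
  have hinv : (t : ℝ)⁻¹ ≤ 1 := inv_le_one_of_one_le₀ ht'
  have hinv₀ : 0 < (t : ℝ)⁻¹ := by positivity
  have hb := one_add_mul_le_pow (a := -(625 * ((t : ℝ)⁻¹ / 10000))) (by linarith) t
  have e : (t : ℝ) * -(625 * ((t : ℝ)⁻¹ / 10000)) = -(1 / 16) := by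
    field_simp; norm_num
  rw [e, ← sub_eq_add_neg, ← sub_eq_add_neg] at hb
  calc lowerConst k * (t : ℝ)⁻¹
      = (1 / 100) ^ k * (1 / 2 * ((t : ℝ)⁻¹ / 10000 / 16384)) := by unfold lowerConst; ring
    _ ≤ _ := by
      refine mul_le_mul_of_nonneg_left (mul_le_mul_of_nonneg_right ?_ ?_) ?_
      · linarith
      · positivity
      · positivity

theorem lowerConst_mul_log_le_integral (hk : 1 ≤ k) (hv : ∀ i, Measurable (v i))
    (hw : ∀ t j, Measurable (w t j))
    (hvu : ∀ i, pdf.IsUniform (v i) unitSquare P volume)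
    (hu : ∀ t j, pdf.IsUniform (w t j) unitSquare P volume)
    (hi : iIndepFun (Sum.elim v fun p : ℕ × Fin 2 => w p.1 p.2) P) (n : ℕ) :
    lowerConst k * Real.log ((n + 1 : ℕ) : ℝ) ≤
      ∫ ω, ((randomGroup v w (n + 1) ω).ncard : ℝ) ∂P := by
  -- The shift drops the round of index 0, for which `cornerScale` takes the value 0. Each event
  -- adds a member in its own round, so the number of events that occur bounds the cardinality from
  -- below.
  let E : ℕ → Set Ω := fun t => cornerEvent v w (cornerScale (t + 1)) (t + 1)
  have hE : ∀ t, MeasurableSet (E t) := fun t => measurableSet_cornerEvent hv hw _ _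
  have hint : ∀ t, Integrable ((E t).indicator fun _ => (1 : ℝ)) P := fun t =>
    (integrable_const 1).indicator (hE t)
  have hstep : ∀ ω, (∀ i, v i ω ∈ unitSquare) ∧ (∀ t j, w t j ω ∈ unitSquare) →
      ∑ t ∈ Finset.range n, (E t).indicator (fun _ => (1 : ℝ)) ω ≤
        ((randomGroup v w (n + 1) ω).ncard : ℝ) := by
    rintro ω ⟨h₁, h₂⟩
    induction n with
    | zero => simp
    | succ n ih =>
      rw [Finset.sum_range_succ]
      by_cases h : ω ∈ E n
      · rw [Set.indicator_of_mem h]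
        have := ncard_add_one_le_of_mem_cornerEvent hk (cornerScale_pos n.succ_pos)
          (cornerScale_le n.succ_pos) h h₁ h₂
        have h' : ((randomGroup v w (n + 1) ω).ncard : ℝ) + 1 ≤
          (randomGroup v w (n + 1 + 1) ω).ncard := by exact_mod_cast this
        linarith
      · rw [Set.indicator_of_notMem h, add_zero]
        refine ih.trans (Nat.cast_le.2 (Set.ncard_le_ncard ?_ (randomGroup_finite v w _ ω)))
        exact socialGroup_mono _ _ (Nat.le_succ _)
  calc lowerConst k * Real.log ((n + 1 : ℕ) : ℝ)
      ≤ lowerConst k * ((harmonic n : ℚ) : ℝ) :=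
        mul_le_mul_of_nonneg_left (log_add_one_le_harmonic n) (lowerConst_pos k).le
    _ = ∑ t ∈ Finset.range n, lowerConst k * ((t + 1 : ℕ) : ℝ)⁻¹ := by
        rw [← Finset.mul_sum, harmonic]
        push_cast
        rfl
    _ ≤ ∑ t ∈ Finset.range n, P.real (E t) :=
        Finset.sum_le_sum fun t _ => lowerConst_div_le_measureReal hv hw hvu hu hi t.succ_pos
    _ = ∫ ω, ∑ t ∈ Finset.range n, (E t).indicator (fun _ => (1 : ℝ)) ω ∂P := by
        rw [integral_finsetSum _ fun t _ => hint t]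
        exact Finset.sum_congr rfl fun t _ => (integral_indicator_one (hE t)).symm
    _ ≤ _ := by
        refine integral_mono_ae (integrable_finsetSum _ fun t _ => hint t)
          (integrable_ncard_randomGroup P hv hw _) ?_
        filter_upwards [ae_forall_mem_unitSquare hv hw hvu hu] with ω hω
        exact hstep ω hω

end LowerBound

theorem theorem1 (k : ℕ) (hk : 1 ≤ k) :
    ∃ c C : ℝ, 0 < c ∧ 0 < C ∧
      ∀ (Ω : Type*) [MeasurableSpace Ω] (P : Measure Ω) [IsProbabilityMeasure P]
        (v : Fin k → Ω → EuclideanSpace ℝ (Fin 2))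
        (w : ℕ → Fin 2 → Ω → EuclideanSpace ℝ (Fin 2)),
        (∀ i, Measurable (v i)) → (∀ t j, Measurable (w t j)) →
        (∀ i, pdf.IsUniform (v i) unitSquare P volume) →
        (∀ t j, pdf.IsUniform (w t j) unitSquare P volume) →
        iIndepFun (Sum.elim v fun p : ℕ × Fin 2 => w p.1 p.2) P →
        (∀ T : ℕ, Integrable (fun ω => ((randomGroup v w T ω).ncard : ℝ)) P) ∧
        (∀ T : ℕ, 1 ≤ T →
          c * Real.log T ≤ ∫ ω, ((randomGroup v w T ω).ncard : ℝ) ∂P) ∧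
        (∀ T : ℕ, 3 ≤ T →
          ∫ ω, ((randomGroup v w T ω).ncard : ℝ) ∂P
            ≤ C * (Real.log T * Real.log (Real.log T))) := by
  obtain ⟨C, hC, hbound⟩ := exists_forall_le_mul_log_mul_log_log k
  refine ⟨lowerConst k, C, lowerConst_pos k, hC, ?_⟩
  intro Ω _ P _ v w hv hw hvu hu hi
  refine ⟨integrable_ncard_randomGroup P hv hw, fun T hT => ?_, fun T hT => ?_⟩
  · obtain ⟨n, rfl⟩ : ∃ n, T = n + 1 := ⟨T - 1, by omega⟩
    exact lowerConst_mul_log_le_integral hk hv hw hvu hu hi n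
  · obtain ⟨J, hJ⟩ := hbound T hT
    exact (integral_ncard_le hv hw hvu hu hi J T).trans hJ
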